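/- **Theorem 2.4.** For each $k\ge 1$ let $n_k,m_k\ge 2$ be integers and let $\mathcal D_k\subseteq\{0,\dots,n_k-1\}\times\{0,\dots,m_k-1\}$ with $r_k:=\operatorname{card}\mathcal D_k\ge 2$. For $w\in\mathcal D_k$ put $\Phi_w(x)=T_k(x+w)$, $x\in\mathbb R^2$, where $T_k=\operatorname{diag}(n_k^{-1},m_k^{-1})$, and for $\mathbf w=w_1\cdots w_k\in\Sigma^k=\prod_{j=1}^k\mathcal D_j$ put $\Phi_{\mathbf w}=\Phi_{w_1}\circ\cdots\circ\Phi_{w_k}$. Let $$E=\bigcap_{k=1}^{\infty}\ \bigcup_{\mathbf w\in\Sigma^k}\Phi_{\mathbf w}([0,1]^2)$$ be the associated self-affine Moran set, and assume that $N^+=\sup\{n_k,m_k:k\ge 1\}<\infty$. Let $$s_k=\operatorname{card}\{j:(i,j)\in\mathcal D_k\text{ for some }i\},\qquad \widehat s_k=\operatorname{card}\{i:(i,j)\in\mathcal D_k\text{ for some }j\}.$$ For $k\ge 1$ let $l=l(k)\geq 1$ be the unique integer with $$\frac1{n_1\cdots n_l}\le\frac1{m_1\cdots m_k}<\frac1{n_1\cdots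 n_{l-1}},$$ and let $$N_{l,k}(E)=\begin{cases} r_1\cdots r_l\,s_{l+1}\cdots s_k, & l\le k,\\ r_1\cdots r_k\,\widehat s_{k+1}\cdots\widehat s_l, & l>k.\end{cases}$$ Put $$d^*=\limsup_{k\to\infty}\frac{\log N_{l(k),k}(E)}{\log (m_1\cdots m_k)},\qquad d_*=\liminf_{k\to\infty}\frac{\log N_{l(k),k}(E)}{\log (m_1\cdots m_k)}.$$ Then the packing dimension $\dim_{\mathrm P}E$ and the upper and lower box-counting dimensions $\overline{\dim}_{\mathrm B}E$, $\underline{\dim}_{\mathrm B}E$ of $E$ (with respect to the Euclidean metric) satisfy $$\dim_{\mathrm P}E=\overline{\dim}_{\mathrm B}E=d^*,\qquad \underline{\dim}_{\mathrm B}E=d_*.$$ -/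

import Mathlib

open Filter Topology
open scoped NNReal ENNReal

noncomputable section

/-- The plane `ℝ²` with its Euclidean metric. -/
abbrev Plane : Type := EuclideanSpace ℝ (Fin 2)

namespace Plane

/-! ### Box-counting dimensions -/

/-- `log N_δ(F) / (-log δ)`, where `N_δ(F)` is the least number of closed balls of radius `δ`
that cover `F` (possibly `∞`). -/
def boxRatio (F : Set Plane) (δ : ℝ≥0) : EReal :=
  ENNReal.log ((Metric.externalCoveringNumber δ F : ℕ∞) : ℝ≥0∞) / ((-Real.log δ : ℝ) : EReal)

/-- The upper box-counting dimension of `F ⊆ ℝ²`: the upper limit as `δ → 0+`. -/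
def upperBoxDim (F : Set Plane) : EReal :=
  limsup (boxRatio F) (𝓝[>] (0 : ℝ≥0))

/-- The lower box-counting dimension of `F ⊆ ℝ²`: the lower limit as `δ → 0+`. -/
def lowerBoxDim (F : Set Plane) : EReal :=
  liminf (boxRatio F) (𝓝[>] (0 : ℝ≥0))

/-! ### Packing measure and packing dimension -/

/-- A finite `δ`-packing of `F`, recorded as a finite set of pairs (centre, radius): the closed
balls `B(x, r)` are pairwise disjoint, centred in `F`, with radii in `(0, δ]`. -/
def IsPacking (F : Set Plane) (δ : ℝ) (P : Finset (Plane × ℝ)) : Prop :=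
  (∀ b ∈ P, b.1 ∈ F ∧ 0 < b.2 ∧ b.2 ≤ δ) ∧
    (P : Set (Plane × ℝ)).PairwiseDisjoint fun b => Metric.closedBall b.1 b.2

/-- `P^s_δ(F)`: the supremum of `∑ |B_i|^s` over the `δ`-packings `{B_i}` of `F`, where
`|B(x, r)| = 2 r` is the diameter. (Restricting to finite packings does not change the
supremum over countable ones.) -/
def packingSup (s : ℝ≥0) (δ : ℝ) (F : Set Plane) : ℝ≥0∞ :=
  ⨆ (P : Finset (Plane × ℝ)) (_ : IsPacking F δ P), ∑ b ∈ P, ENNReal.ofReal (2 * b.2) ^ (s : ℝ)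

/-- The `s`-dimensional packing pre-measure `P^s_0(F) = lim_{δ → 0+} P^s_δ(F)`; the limit is an
infimum because `P^s_δ(F)` is nondecreasing in `δ`. -/
def packingPreMeasure (s : ℝ≥0) (F : Set Plane) : ℝ≥0∞ :=
  ⨅ (δ : ℝ) (_ : 0 < δ), packingSup s δ F

/-- The `s`-dimensional packing (outer) measure
`P^s(F) = inf {∑ P^s_0(F_i) : F ⊆ ⋃ F_i}` over countable covers. -/
def packingMeasure (s : ℝ≥0) (F : Set Plane) : ℝ≥0∞ :=
  ⨅ (G : ℕ → Set Plane) (_ : F ⊆ ⋃ i, G i), ∑' i, packingPreMeasure s (G i)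

/-- The packing dimension `sup {s ≥ 0 : P^s(F) = ∞}`. -/
def packingDim (F : Set Plane) : ℝ≥0∞ :=
  ⨆ (s : ℝ≥0) (_ : packingMeasure s F = ∞), (s : ℝ≥0∞)

end Plane

/-! ### Self-affine Moran sets -/

/-- The data `{(n_k, m_k, D_k)}_{k ≥ 1}` of a self-affine Moran construction. Levels are indexed
from `0`: `n k`, `m k`, `D k` are the data of the level that is usually numbered `k + 1`. Thus
products over the levels `1, …, k` are products over `Finset.range k`. -/
structure MoranConstruction where
  /-- number of columns of each level -/
  n : ℕ → ℕ
  /-- number of rows of each level -/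
  m : ℕ → ℕ
  /-- the digit set of each level -/
  D : ℕ → Finset (ℕ × ℕ)
  two_le_n : ∀ k, 2 ≤ n k
  two_le_m : ∀ k, 2 ≤ m k
  D_subset : ∀ k, D k ⊆ Finset.range (n k) ×ˢ Finset.range (m k)
  two_le_card : ∀ k, 2 ≤ (D k).card

namespace MoranConstruction

variable (A : MoranConstruction)

/-- `N⁺ = sup {n_k, m_k : k}`, in `ℕ ∪ {∞}`. -/
def Nplus : ℕ∞ := ⨆ k, max (A.n k : ℕ∞) (A.m k : ℕ∞)

/-- The affine map `Φ_w(x) = T_k (x + w)` with `T_k = diag (1 / n_k, 1 / m_k)`. -/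
def digitMap (k : ℕ) (w : ℕ × ℕ) (x : Plane) : Plane :=
  !₂[(x 0 + w.1) / A.n k, (x 1 + w.2) / A.m k]

/-- The composition `Φ_{w_1} ∘ Φ_{w_2} ∘ ⋯ ∘ Φ_{w_k}` along a word of length `k`. -/
def wordMap : (k : ℕ) → (Fin k → ℕ × ℕ) → Plane → Plane
  | 0, _ => id
  | k + 1, w => wordMap k (Fin.init w) ∘ A.digitMap k (w (Fin.last k))

/-- The set `Σ^k = D_1 × ⋯ × D_k` of admissible words of length `k`. -/
def words (k : ℕ) : Set (Fin k → ℕ × ℕ) := {w | ∀ i : Fin k, w i ∈ A.D i}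

/-- The unit square `J = [0,1]²`. -/
def unitSquare : Set Plane := {x | ∀ i, x i ∈ Set.Icc (0 : ℝ) 1}

/-- The self-affine Moran set `E = ⋂_{k ≥ 1} ⋃_{w ∈ Σ^k} Φ_w(J)`. -/
def moranSet : Set Plane :=
  ⋂ (k : ℕ) (_ : 1 ≤ k), ⋃ w ∈ A.words k, A.wordMap k w '' unitSquare

/-- `n_1 ⋯ n_k`. -/
def nProd (k : ℕ) : ℕ := ∏ i ∈ Finset.range k, A.n i

/-- `m_1 ⋯ m_k`. -/
def mProd (k : ℕ) : ℕ := ∏ i ∈ Finset.range k, A.m i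

/-- `r_k = card D_k`. -/
def r (k : ℕ) : ℕ := (A.D k).card

/-- `s_k = card {j : (i, j) ∈ D_k for some i}`, the number of nonempty rows. -/
def s (k : ℕ) : ℕ := ((A.D k).image Prod.snd).card

/-- `ŝ_k = card {i : (i, j) ∈ D_k for some j}`, the number of nonempty columns. -/
def sHat (k : ℕ) : ℕ := ((A.D k).image Prod.fst).card

theorem exists_mProd_le_nProd (k : ℕ) : ∃ l, A.mProd k ≤ A.nProd l := by
  refine ⟨A.mProd k, ?_⟩
  calc A.mProd k ≤ 2 ^ A.mProd k := Nat.lt_two_pow_self.le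
    _ = ∏ _i ∈ Finset.range (A.mProd k), 2 := by simp
    _ ≤ A.nProd (A.mProd k) := Finset.prod_le_prod' fun i _ => A.two_le_n i

open Classical in
/-- `l(k)`: the unique integer `l` with `1/(n_1⋯n_l) ≤ 1/(m_1⋯m_k) < 1/(n_1⋯n_{l-1})`
(for `k ≥ 1`; see `ell_eq_iff`), obtained as the least `l` with the first inequality. -/
def ell (k : ℕ) : ℕ := Nat.find (A.exists_mProd_le_nProd k)

/-- For `k ≥ 1`, `l(k)` is characterized by its two defining inequalities. -/
theorem ell_eq_iff {k : ℕ} (hk : 1 ≤ k) (l : ℕ) :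
    A.ell k = l ↔ 1 ≤ l ∧ (1 / (A.nProd l : ℝ) ≤ 1 / (A.mProd k : ℝ)) ∧
      1 / (A.mProd k : ℝ) < 1 / (A.nProd (l - 1) : ℝ) := by
  have hn : ∀ l, 0 < A.nProd l := fun l =>
    Finset.prod_pos fun i _ => lt_of_lt_of_le two_pos (A.two_le_n i)
  have hm : ∀ l, 0 < A.mProd l := fun l =>
    Finset.prod_pos fun i _ => lt_of_lt_of_le two_pos (A.two_le_m i)
  have hmono : Monotone A.nProd := monotone_nat_of_le_succ fun l => by
    rw [nProd, nProd, Finset.prod_range_succ]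
    exact Nat.le_mul_of_pos_right _ (lt_of_lt_of_le two_pos (A.two_le_n l))
  have hk1 : 1 < A.mProd k := by
    calc 1 < 2 ^ k := Nat.one_lt_two_pow (by omega)
      _ = ∏ _i ∈ Finset.range k, 2 := by simp
      _ ≤ A.mProd k := Finset.prod_le_prod' fun i _ => A.two_le_m i
  have hR : ∀ a b : ℕ, 0 < a → 0 < b → (1 / (a : ℝ) ≤ 1 / (b : ℝ) ↔ b ≤ a) := by
    intro a b ha hb
    rw [one_div_le_one_div (by exact_mod_cast ha) (by exact_mod_cast hb)]
    exact_mod_cast Iff.rfl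
  rw [hR _ _ (hn _) (hm _), ← not_le, hR _ _ (hn _) (hm _), ell, Nat.find_eq_iff]
  constructor
  · rintro ⟨h1, h2⟩
    have hl : 1 ≤ l := by
      rcases Nat.eq_zero_or_pos l with rfl | h
      · simp [nProd] at h1
        omega
      · exact h
    exact ⟨hl, h1, h2 _ (by omega)⟩
  · rintro ⟨hl, h1, h2⟩
    exact ⟨h1, fun j hj h => h2 (h.trans (hmono (by omega)))⟩

/-- `N_{l,k} = r_1⋯r_l s_{l+1}⋯s_k` if `l ≤ k`, and `r_1⋯r_k ŝ_{k+1}⋯ŝ_l` if `l > k`. -/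
def count (l k : ℕ) : ℕ :=
  if l ≤ k then (∏ i ∈ Finset.range l, A.r i) * ∏ i ∈ Finset.Ico l k, A.s i
  else (∏ i ∈ Finset.range k, A.r i) * ∏ i ∈ Finset.Ico k l, A.sHat i

/-- The ratio `log N_{l(k),k} / log (m_1⋯m_k)`. -/
def dimRatio (k : ℕ) : ℝ := Real.log (A.count (A.ell k) k) / Real.log (A.mProd k)

/-- `d^*`, the upper limit of the ratios. -/
def dUpper : EReal := limsup (fun k => (A.dimRatio k : EReal)) atTop

/-- `d_*`, the lower limit of the ratios. -/
def dLower : EReal := liminf (fun k => (A.dimRatio k : EReal)) atTop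

end MoranConstruction

end

/-! Write M_k = m_1⋯m_k and let B bound all n_i and m_i. Prescribing the first l(k) column digits
and the first k row digits cuts out a rectangle of height 1/M_k whose width, by the choice of l(k),
lies between 1/(B M_k) and 1/M_k: an approximate square. The admissible ones number exactly
N_{l(k),k} (`card_rectGrid_D`); together they cover E, and each contains a point of E. Hence the
covering number of E at scale 1/M_k equals N_{l(k),k} up to a factor depending only on B:
`externalCoveringNumber_le` gives one side, and thinning the rectangles to a separated family
(`IsBound.exists_separated`) gives the other. Since M_{k+1} ≤ B M_k, this extends to every small δ,
and the bounded factors disappear after division by log(1/δ) (`IsBound.tendsto_boxRatio_sub`). Both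
box dimensions follow.

For the packing dimension, sort the balls of a packing by scale. At most a constant times N_{l(k),k}
of them have radius between 1/M_{k+1} and 1/M_k, so for s > d^* the sums are dominated by a
geometric series (`IsBound.packingMeasure_ne_top`). Conversely, for any countable cover of E,
Baire's theorem gives one piece that is dense in a whole cylinder of E
(`exists_cylinder_subset_closure`). Fixing the finitely many digits of that cylinder reduces the
counts only by a constant factor, so for s < d^* that piece alone has infinite pre-measure
(`IsBound.packingPreMeasure_eq_top`). -/

/-! ### Integer codes of digit sequences -/

/-- The integer with mixed-radix digits `d 0, …, d (k - 1)` in the bases `n 0, …, n (k - 1)`. -/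
def digitCode (n d : ℕ → ℕ) : ℕ → ℕ
  | 0 => 0
  | k + 1 => n k * digitCode n d k + d k

/-- `x` lies in the interval of length `1 / (n 0 ⋯ n (k - 1))` coded by the first `k` digits. -/
def CodedBy (n d : ℕ → ℕ) (k : ℕ) (x : ℝ) : Prop :=
  (digitCode n d k : ℝ) ≤ x * (∏ i ∈ Finset.range k, n i : ℕ) ∧
    x * (∏ i ∈ Finset.range k, n i : ℕ) ≤ digitCode n d k + 1

theorem digitCode_congr {n d d' : ℕ → ℕ} {k : ℕ} (h : ∀ i < k, d i = d' i) :
    digitCode n d k = digitCode n d' k := by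
  induction k with
  | zero => rfl
  | succ k ih => rw [digitCode, digitCode, ih fun i hi => h i (by omega), h k (by omega)]

theorem CodedBy.of_succ {n d : ℕ → ℕ} {k : ℕ} {x : ℝ} (hd : d k < n k)
    (h : CodedBy n d (k + 1) x) : CodedBy n d k x := by
  obtain ⟨h1, h2⟩ := h
  rw [digitCode, Finset.prod_range_succ] at h1 h2
  push_cast at h1 h2
  have hn : (0 : ℝ) < n k := by exact_mod_cast (Nat.zero_le _).trans_lt hd
  have hd' : (d k : ℝ) + 1 ≤ n k := by exact_mod_cast hd
  have hd0 : (0 : ℝ) ≤ d k := by positivity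
  unfold CodedBy
  push_cast
  constructor
  · refine le_of_mul_le_mul_left ?_ hn
    nlinarith
  · refine le_of_mul_le_mul_left ?_ hn
    nlinarith

theorem CodedBy.mono {n d : ℕ → ℕ} (hd : ∀ i, d i < n i) {k l : ℕ} (hkl : k ≤ l) {x : ℝ}
    (h : CodedBy n d l x) : CodedBy n d k x := by
  induction hkl with
  | refl => exact h
  | step _ ih => exact ih (h.of_succ (hd _))

theorem CodedBy.congr {n d d' : ℕ → ℕ} {k : ℕ} {x : ℝ} (hd : ∀ i < k, d i = d' i)
    (h : CodedBy n d k x) : CodedBy n d' k x := by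
  unfold CodedBy at *
  rwa [← digitCode_congr hd]

theorem exists_codedBy {n d : ℕ → ℕ} (hd : ∀ i, d i < n i) : ∃ x, ∀ k, CodedBy n d k x := by
  set P : ℕ → ℝ := fun k => (∏ i ∈ Finset.range k, n i : ℕ) with hP
  have hn : ∀ k, 0 < n k := fun k => (Nat.zero_le _).trans_lt (hd k)
  have hpos : ∀ k, 0 < P k := fun k => by
    simpa [hP] using Finset.prod_pos fun i _ => (Nat.cast_pos (α := ℝ)).2 (hn i)
  have hmem : ∀ k x, x ∈ Set.Icc (digitCode n d k / P k) ((digitCode n d k + 1) / P k) ↔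
      CodedBy n d k x := fun k x => by
    rw [Set.mem_Icc, div_le_iff₀ (hpos k), le_div_iff₀ (hpos k)]
    rfl
  have hanti : Antitone fun k => Set.Icc (digitCode n d k / P k) ((digitCode n d k + 1) / P k) :=
    antitone_nat_of_succ_le fun k x hx =>
      (hmem k x).2 (((hmem (k + 1) x).1 hx).of_succ (hd k))
  have := ciSup_mem_iInter_Icc_of_antitone_Icc hanti fun k => by
    have := hpos k
    gcongr
    linarith
  rw [Set.mem_iInter] at this
  exact ⟨_, fun k => (hmem k _).1 (this k)⟩

/-! ### Planar grids of codes -/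

/-- The pairs of codes of length `K` in the bases `u`, `v` with joint digits in `F`. -/
def codeGrid (u v : ℕ → ℕ) (F : ℕ → Finset (ℕ × ℕ)) : ℕ → Finset (ℕ × ℕ)
  | 0 => {(0, 0)}
  | K + 1 => (codeGrid u v F K ×ˢ F K).image fun q =>
      (u K * q.1.1 + q.2.1, v K * q.1.2 + q.2.2)

theorem mul_add_inj {n a b d e : ℕ} (hd : d < n) (he : e < n) (h : n * a + d = n * b + e) :
    a = b ∧ d = e := by
  have h1 := congrArg (· % n) h
  have h2 := congrArg (· / n) h
  simp only [Nat.mul_add_mod, Nat.mod_eq_of_lt hd, Nat.mod_eq_of_lt he] at h1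
  have hn : 0 < n := by omega
  simp only [Nat.mul_add_div hn, Nat.div_eq_of_lt hd, Nat.div_eq_of_lt he] at h2
  exact ⟨by simpa using h2, h1⟩

/-- Digits smaller than their base can be recovered from the code by division with remainder, so
distinct words give distinct pairs of codes. -/
theorem card_codeGrid {u v : ℕ → ℕ} {F : ℕ → Finset (ℕ × ℕ)}
    (hF : ∀ i, F i ⊆ Finset.range (u i) ×ˢ Finset.range (v i)) (K : ℕ) :
    (codeGrid u v F K).card = ∏ i ∈ Finset.range K, (F i).card := by
  induction K with
  | zero => rfl
  | succ K ih =>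
    rw [codeGrid, Finset.card_image_of_injOn, Finset.card_product, ih, Finset.prod_range_succ]
    rintro ⟨⟨a, b⟩, d, e⟩ h ⟨⟨a', b'⟩, d', e'⟩ h' heq
    simp only [Finset.coe_product, Set.mem_prod, Finset.mem_coe] at h h'
    have h1 := hF K h.2
    have h2 := hF K h'.2
    simp only [Finset.mem_product, Finset.mem_range] at h1 h2
    simp only [Prod.mk.injEq] at heq
    obtain ⟨rfl, rfl⟩ := mul_add_inj h1.1 h2.1 heq.1
    obtain ⟨rfl, rfl⟩ := mul_add_inj h1.2 h2.2 heq.2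
    rfl

theorem mem_codeGrid {u v : ℕ → ℕ} {F : ℕ → Finset (ℕ × ℕ)} {f : ℕ → ℕ × ℕ}
    (hf : ∀ i, f i ∈ F i) (K : ℕ) :
    (digitCode u (fun i => (f i).1) K, digitCode v (fun i => (f i).2) K) ∈ codeGrid u v F K := by
  induction K with
  | zero => simp [codeGrid, digitCode]
  | succ K ih =>
    exact Finset.mem_image.2 ⟨(_, f K), Finset.mem_product.2 ⟨ih, hf K⟩, rfl⟩

theorem exists_of_mem_codeGrid {u v : ℕ → ℕ} {F : ℕ → Finset (ℕ × ℕ)}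
    (hF : ∀ i, (F i).Nonempty) {K : ℕ} {q : ℕ × ℕ} (hq : q ∈ codeGrid u v F K) :
    ∃ f : ℕ → ℕ × ℕ, (∀ i, f i ∈ F i) ∧ digitCode u (fun i => (f i).1) K = q.1 ∧
      digitCode v (fun i => (f i).2) K = q.2 := by
  induction K generalizing q with
  | zero =>
    choose f hf using hF
    simp only [codeGrid, Finset.mem_singleton] at hq
    exact ⟨f, hf, by simp [hq, digitCode], by simp [hq, digitCode]⟩
  | succ K ih =>
    obtain ⟨⟨p, w⟩, hp, rfl⟩ := Finset.mem_image.1 hq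
    rw [Finset.mem_product] at hp
    obtain ⟨f, hf, h1, h2⟩ := ih hp.1
    refine ⟨Function.update f K w, fun i => ?_, ?_, ?_⟩
    · rcases eq_or_ne i K with rfl | h
      · simpa using hp.2
      · simpa [h] using hf i
    · rw [digitCode, ← h1, digitCode_congr (d' := fun i => (f i).1) fun i hi => by
        simp [hi.ne]]
      simp
    · rw [digitCode, ← h2, digitCode_congr (d' := fun i => (f i).2) fun i hi => by
        simp [hi.ne]]
      simp

/-- A digit 0 in base 1 changes nothing. Padding in this way lets a rectangle with different numbers
of column and row digits be treated as a word of one common length. -/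
theorem digitCode_truncate {n d : ℕ → ℕ} {l K : ℕ} (h : l ≤ K) :
    digitCode (fun i => if i < l then n i else 1) (fun i => if i < l then d i else 0) K =
      digitCode n d l := by
  induction h with
  | refl =>
    suffices ∀ k ≤ l, digitCode (fun i => if i < l then n i else 1)
        (fun i => if i < l then d i else 0) k = digitCode n d k from this l le_rfl
    intro k hk
    induction k with
    | zero => rfl
    | succ k ih =>
      have : k < l := hk
      simp [digitCode, ih (by omega), this]
  | @step K hK ih =>
    have : ¬ K < l := not_lt.2 hK
    simp [digitCode, ih, this]

/-! ### Approximate squares -/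

namespace MoranConstruction

variable (A : MoranConstruction)

theorem digit_lt {k : ℕ} {w : ℕ × ℕ} (h : w ∈ A.D k) : w.1 < A.n k ∧ w.2 < A.m k := by
  simpa using A.D_subset k h

theorem nonempty_D (k : ℕ) : (A.D k).Nonempty :=
  Finset.card_pos.1 (two_pos.trans_le (A.two_le_card k))

theorem nProd_pos (k : ℕ) : 0 < A.nProd k :=
  Finset.prod_pos fun i _ => two_pos.trans_le (A.two_le_n i)

theorem mProd_pos (k : ℕ) : 0 < A.mProd k :=
  Finset.prod_pos fun i _ => two_pos.trans_le (A.two_le_m i)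

/-- `x` lies in the rectangle determined by the first `l` column digits and the first `k` row
digits of `f`. -/
def InRectangle (f : ℕ → ℕ × ℕ) (l k : ℕ) (x : Plane) : Prop :=
  CodedBy A.n (fun i => (f i).1) l (x 0) ∧ CodedBy A.m (fun i => (f i).2) k (x 1)

theorem InRectangle.mono {A : MoranConstruction} {f : ℕ → ℕ × ℕ} (hf : ∀ i, f i ∈ A.D i)
    {l k l' k' : ℕ} (hl : l ≤ l') (hk : k ≤ k') {x : Plane} (h : A.InRectangle f l' k' x) :
    A.InRectangle f l k x :=
  ⟨h.1.mono (fun i => (A.digit_lt (hf i)).1) hl, h.2.mono (fun i => (A.digit_lt (hf i)).2) hk⟩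

/-- The innermost map carries the last, least significant digit, so the induction substitutes the
image of `x` under that map; hence `x` is generalized. -/
theorem wordMap_apply (f : ℕ → ℕ × ℕ) (k : ℕ) (x : Plane) :
    A.wordMap k (fun i => f i) x =
      !₂[(digitCode A.n (fun i => (f i).1) k + x 0) / A.nProd k,
        (digitCode A.m (fun i => (f i).2) k + x 1) / A.mProd k] := by
  induction k generalizing x with
  | zero =>
    ext i
    fin_cases i <;> simp [wordMap, digitCode, nProd, mProd]
  | succ k ih =>
    have h1 := (Nat.cast_pos (α := ℝ)).2 (A.nProd_pos k)
    have h2 := (Nat.cast_pos (α := ℝ)).2 (A.mProd_pos k)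
    have h3 : (0 : ℝ) < A.n k := by exact_mod_cast two_pos.trans_le (A.two_le_n k)
    have h4 : (0 : ℝ) < A.m k := by exact_mod_cast two_pos.trans_le (A.two_le_m k)
    have hn : A.nProd (k + 1) = A.nProd k * A.n k := Finset.prod_range_succ _ _
    have hm : A.mProd (k + 1) = A.mProd k * A.m k := Finset.prod_range_succ _ _
    have hw : Fin.init (fun i : Fin (k + 1) => f i) = fun i : Fin k => f i := rfl
    rw [wordMap, Function.comp_apply, hw, ih, hn, hm]
    ext i
    fin_cases i
    · simp [digitMap, digitCode]
      field_simp
      ring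
    · simp [digitMap, digitCode]
      field_simp
      ring

theorem mem_wordMap_image_iff (f : ℕ → ℕ × ℕ) (k : ℕ) (x : Plane) :
    x ∈ A.wordMap k (fun i => f i) '' unitSquare ↔ A.InRectangle f k k x := by
  have h1 := (Nat.cast_pos (α := ℝ)).2 (A.nProd_pos k)
  have h2 := (Nat.cast_pos (α := ℝ)).2 (A.mProd_pos k)
  unfold InRectangle CodedBy
  change _ ↔ (_ ≤ x 0 * (A.nProd k : ℝ) ∧ x 0 * (A.nProd k : ℝ) ≤ _) ∧
    (_ ≤ x 1 * (A.mProd k : ℝ) ∧ x 1 * (A.mProd k : ℝ) ≤ _)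
  constructor
  · rintro ⟨y, hy, rfl⟩
    have hy0 := hy 0
    have hy1 := hy 1
    rw [wordMap_apply]
    simp only [Set.mem_Icc] at hy0 hy1
    simp [h1.ne', h2.ne', hy0, hy1]
  · rintro ⟨⟨h3, h4⟩, h5, h6⟩
    refine ⟨!₂[x 0 * A.nProd k - digitCode A.n (fun i => (f i).1) k,
      x 1 * A.mProd k - digitCode A.m (fun i => (f i).2) k], ?_, ?_⟩
    · intro i
      fin_cases i <;> simp <;> constructor <;> linarith
    · rw [wordMap_apply]
      ext i
      fin_cases i <;> simp [h1.ne', h2.ne']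

theorem mem_moranSet_iff (x : Plane) :
    x ∈ A.moranSet ↔ ∀ k, 1 ≤ k → ∃ f : ℕ → ℕ × ℕ, (∀ i, f i ∈ A.D i) ∧ A.InRectangle f k k x := by
  simp only [moranSet, Set.mem_iInter, Set.mem_iUnion]
  refine forall₂_congr fun k _ => ?_
  constructor
  · rintro ⟨w, hw, hx⟩
    choose g hg using A.nonempty_D
    let f : ℕ → ℕ × ℕ := fun i => if h : i < k then w ⟨i, h⟩ else g i
    have hfw : (fun i : Fin k => f i) = w := by
      ext i <;> simp [f]
    refine ⟨f, fun i => ?_, (A.mem_wordMap_image_iff f k x).1 (hfw ▸ hx)⟩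
    by_cases h : i < k
    · simpa [f, h] using hw ⟨i, h⟩
    · simpa [f, h] using hg i
  · rintro ⟨f, hf, hx⟩
    exact ⟨fun i => f i, fun i => hf i, (A.mem_wordMap_image_iff f k x).2 hx⟩

/-- The digit sequence may depend on `l` and `k`; a single infinite coding of `x` is never needed.
-/
theorem exists_inRectangle {x : Plane} (hx : x ∈ A.moranSet) (l k : ℕ) :
    ∃ f : ℕ → ℕ × ℕ, (∀ i, f i ∈ A.D i) ∧ A.InRectangle f l k x := by
  obtain ⟨f, hf, h⟩ := (A.mem_moranSet_iff x).1 hx (max l k + 1) (by omega)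
  exact ⟨f, hf, h.mono hf (by omega) (by omega)⟩

theorem exists_mem_moranSet {f : ℕ → ℕ × ℕ} (hf : ∀ i, f i ∈ A.D i) :
    ∃ x ∈ A.moranSet, ∀ l k, A.InRectangle f l k x := by
  obtain ⟨a, ha⟩ := exists_codedBy fun i => (A.digit_lt (hf i)).1
  obtain ⟨b, hb⟩ := exists_codedBy fun i => (A.digit_lt (hf i)).2
  have h : ∀ l k, A.InRectangle f l k !₂[a, b] := fun l k => ⟨ha l, hb k⟩
  exact ⟨!₂[a, b], (A.mem_moranSet_iff _).2 fun k _ => ⟨f, hf, h k k⟩, h⟩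

theorem isClosed_moranSet : IsClosed A.moranSet := by
  refine isClosed_iInter fun k => isClosed_iInter fun _ => ?_
  have hfin : (A.words k).Finite := by
    have : A.words k = Set.univ.pi fun i : Fin k => (A.D i : Set (ℕ × ℕ)) := by
      ext w
      simp [words]
    rw [this]
    exact Set.Finite.pi fun i => (A.D i).finite_toSet
  refine hfin.isClosed_biUnion fun w hw => ?_
  choose g hg using A.nonempty_D
  let f : ℕ → ℕ × ℕ := fun i => if h : i < k then w ⟨i, h⟩ else g i
  have hfw : (fun i : Fin k => f i) = w := by
    ext i <;> simp [f]
  have : A.wordMap k w '' unitSquare = {x | A.InRectangle f k k x} := by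
    ext x
    rw [← hfw]
    exact A.mem_wordMap_image_iff f k x
  rw [this]
  have c0 : Continuous fun x : Plane => x 0 := by fun_prop
  have c1 : Continuous fun x : Plane => x 1 := by fun_prop
  unfold InRectangle CodedBy
  simp only [Set.ofPred_and]
  refine IsClosed.inter (IsClosed.inter ?_ ?_) (IsClosed.inter ?_ ?_)
  · exact isClosed_le continuous_const (c0.mul continuous_const)
  · exact isClosed_le (c0.mul continuous_const) continuous_const
  · exact isClosed_le continuous_const (c1.mul continuous_const)
  · exact isClosed_le (c1.mul continuous_const) continuous_const

/-! ### Counting approximate squares -/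

/-- The digit set of level `i` for rectangles with `l` column digits and `k` row digits, when the
joint digits are restricted to `F`. -/
def truncDigits (F : ℕ → Finset (ℕ × ℕ)) (l k i : ℕ) : Finset (ℕ × ℕ) :=
  (F i).image fun w => (if i < l then w.1 else 0, if i < k then w.2 else 0)

/-- The grid positions of the rectangles with `l` column digits and `k` row digits, when the
joint digits are restricted to `F`. -/
def rectGrid (F : ℕ → Finset (ℕ × ℕ)) (l k : ℕ) : Finset (ℕ × ℕ) :=
  codeGrid (fun i => if i < l then A.n i else 1) (fun i => if i < k then A.m i else 1)
    (truncDigits F l k) (max l k)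

theorem mem_rectGrid_iff {F : ℕ → Finset (ℕ × ℕ)} (hF : ∀ i, (F i).Nonempty) {l k : ℕ}
    {q : ℕ × ℕ} : q ∈ A.rectGrid F l k ↔ ∃ f : ℕ → ℕ × ℕ, (∀ i, f i ∈ F i) ∧
      digitCode A.n (fun i => (f i).1) l = q.1 ∧ digitCode A.m (fun i => (f i).2) k = q.2 := by
  constructor
  · intro h
    obtain ⟨g, hg, h1, h2⟩ := exists_of_mem_codeGrid (fun i => (hF i).image _) h
    choose f hf hfg using fun i => Finset.mem_image.1 (hg i)
    refine ⟨f, hf, ?_, ?_⟩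
    · rw [← h1, ← digitCode_truncate (le_max_left l k)]
      congr 1
      ext i
      exact congrArg Prod.fst (hfg i)
    · rw [← h2, ← digitCode_truncate (le_max_right l k)]
      congr 1
      ext i
      exact congrArg Prod.snd (hfg i)
  · rintro ⟨f, hf, h1, h2⟩
    have := mem_codeGrid (u := fun i => if i < l then A.n i else 1)
      (v := fun i => if i < k then A.m i else 1) (F := truncDigits F l k)
      (f := fun i => (if i < l then (f i).1 else 0, if i < k then (f i).2 else 0))
      (fun i => Finset.mem_image_of_mem _ (hf i)) (max l k)
    simp only [digitCode_truncate (le_max_left l k), digitCode_truncate (le_max_right l k)] at this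
    rwa [h1, h2] at this

theorem truncDigits_subset {F : ℕ → Finset (ℕ × ℕ)} (hF : ∀ i, F i ⊆ A.D i) (l k i : ℕ) :
    truncDigits F l k i ⊆ Finset.range (if i < l then A.n i else 1) ×ˢ
      Finset.range (if i < k then A.m i else 1) := by
  intro q hq
  obtain ⟨w, hw, rfl⟩ := Finset.mem_image.1 hq
  have := A.digit_lt (hF i hw)
  rw [Finset.mem_product, Finset.mem_range, Finset.mem_range]
  constructor <;> dsimp only <;> split_ifs <;> omega

theorem card_rectGrid {F : ℕ → Finset (ℕ × ℕ)} (hF : ∀ i, F i ⊆ A.D i) (l k : ℕ) :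
    (A.rectGrid F l k).card = ∏ i ∈ Finset.range (max l k), (truncDigits F l k i).card :=
  card_codeGrid (A.truncDigits_subset hF l k) _

/-- Levels below both cut-offs keep the whole digit and contribute `r`. Between the cut-offs only
one coordinate survives, contributing `s` when it is the row and `sHat` when it is the column. -/
theorem card_rectGrid_D (l k : ℕ) : (A.rectGrid A.D l k).card = A.count l k := by
  have hr : ∀ i, i < l → i < k → (truncDigits A.D l k i).card = A.r i := fun i h1 h2 => by
    simp [truncDigits, h1, h2, r]
  have hs : ∀ i, ¬ i < l → i < k → (truncDigits A.D l k i).card = A.s i := fun i h1 h2 => by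
    have : truncDigits A.D l k i = ((A.D i).image Prod.snd).image fun b => (0, b) := by
      simp [truncDigits, h1, h2, Finset.image_image, Function.comp_def]
    rw [this, Finset.card_image_of_injective _ (Prod.mk_right_injective 0), s]
  have hsh : ∀ i, i < l → ¬ i < k → (truncDigits A.D l k i).card = A.sHat i := fun i h1 h2 => by
    have : truncDigits A.D l k i = ((A.D i).image Prod.fst).image fun a => (a, 0) := by
      simp [truncDigits, h1, h2, Finset.image_image, Function.comp_def]
    rw [this, Finset.card_image_of_injective _ (Prod.mk_left_injective 0), sHat]
  rw [A.card_rectGrid fun _ => subset_rfl, count]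
  split_ifs with h
  · rw [max_eq_right h, ← Finset.prod_range_mul_prod_Ico _ h]
    congr 1 <;> refine Finset.prod_congr rfl fun i hi => ?_
    · rw [Finset.mem_range] at hi
      exact hr i hi (by omega)
    · rw [Finset.mem_Ico] at hi
      exact hs i (by omega) hi.2
  · rw [max_eq_left (by omega), ← Finset.prod_range_mul_prod_Ico _ (not_le.1 h).le]
    congr 1 <;> refine Finset.prod_congr rfl fun i hi => ?_
    · rw [Finset.mem_range] at hi
      exact hr i (by omega) hi
    · rw [Finset.mem_Ico] at hi
      exact hsh i hi.2 (by omega)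

theorem count_pos (l k : ℕ) : 0 < A.count l k := by
  rw [← card_rectGrid_D, A.card_rectGrid fun _ => subset_rfl]
  exact Finset.prod_pos fun i _ => Finset.card_pos.2 ((A.nonempty_D i).image _)

theorem prod_ite_lt {n : ℕ → ℕ} {l K : ℕ} (h : l ≤ K) :
    ∏ i ∈ Finset.range K, (if i < l then n i else 1) = ∏ i ∈ Finset.range l, n i := by
  rw [← Finset.prod_filter]
  congr 1
  ext i
  simp
  omega

theorem count_le (l k : ℕ) : A.count l k ≤ A.nProd l * A.mProd k := by
  rw [← card_rectGrid_D, A.card_rectGrid fun _ => subset_rfl, nProd, mProd,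
    ← prod_ite_lt (le_max_left l k), ← prod_ite_lt (le_max_right l k), ← Finset.prod_mul_distrib]
  refine Finset.prod_le_prod' fun i _ => ?_
  simpa using Finset.card_le_card (A.truncDigits_subset (fun _ => subset_rfl) l k i)

/-- The digit sets in which the first `p` digits are prescribed to be those of `g`. -/
def prefixDigits (g : ℕ → ℕ × ℕ) (p i : ℕ) : Finset (ℕ × ℕ) :=
  if i < p then {g i} else A.D i

theorem prefixDigits_subset {g : ℕ → ℕ × ℕ} (hg : ∀ i, g i ∈ A.D i) (p i : ℕ) :
    A.prefixDigits g p i ⊆ A.D i := by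
  unfold prefixDigits
  split_ifs
  · simpa using hg i
  · exact subset_rfl

theorem nonempty_prefixDigits (g : ℕ → ℕ × ℕ) (p i : ℕ) : (A.prefixDigits g p i).Nonempty := by
  unfold prefixDigits
  split_ifs
  · simp
  · exact A.nonempty_D i

/-- Prescribing a digit at level `i` divides the number of choices there by at most `A.r i`. The
total loss is independent of `l` and `k`, which is what the Baire argument needs. -/
theorem count_le_mul_card_rectGrid {g : ℕ → ℕ × ℕ} (hg : ∀ i, g i ∈ A.D i) (p l k : ℕ) :
    A.count l k ≤ (∏ i ∈ Finset.range p, A.r i) * (A.rectGrid (A.prefixDigits g p) l k).card := by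
  have hr : ∀ i, 1 ≤ A.r i := fun i => one_le_two.trans (A.two_le_card i)
  rw [← card_rectGrid_D, A.card_rectGrid fun _ => subset_rfl,
    A.card_rectGrid (A.prefixDigits_subset hg p)]
  calc ∏ i ∈ Finset.range (max l k), (truncDigits A.D l k i).card
      ≤ ∏ i ∈ Finset.range (max l k),
        ((if i < p then A.r i else 1) * (truncDigits (A.prefixDigits g p) l k i).card) := by
        refine Finset.prod_le_prod' fun i _ => ?_
        split_ifs with h
        · calc (truncDigits A.D l k i).card ≤ A.r i := Finset.card_image_le
            _ ≤ _ := Nat.le_mul_of_pos_right _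
              (Finset.card_pos.2 ((A.nonempty_prefixDigits g p i).image _))
        · simp [truncDigits, prefixDigits, h]
    _ ≤ _ := by
        rw [Finset.prod_mul_distrib]
        gcongr
        -- Since `p` may exceed `max l k`, the range is first enlarged; the added factors are at
        -- least 1.
        calc ∏ i ∈ Finset.range (max l k), (if i < p then A.r i else 1)
            ≤ ∏ i ∈ Finset.range (max (max l k) p), (if i < p then A.r i else 1) :=
              Finset.prod_le_prod_of_subset_of_one_le'
                (Finset.range_mono (le_max_left _ _)) fun i _ _ => by
                  split_ifs
                  exacts [hr i, le_rfl]
          _ = _ := prod_ite_lt (le_max_right _ _)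

end MoranConstruction

/-! ### Coverings and separated subsets -/

namespace Plane

theorem abs_sub_apply_le_dist (x y : Plane) (i : Fin 2) : |x i - y i| ≤ dist x y := by
  rw [dist_eq_norm]
  simpa using PiLp.norm_apply_le (x - y) i

theorem dist_le_add (x y : Plane) : dist x y ≤ |x 0 - y 0| + |x 1 - y 1| := by
  rw [EuclideanSpace.dist_eq, Fin.sum_univ_two, Real.dist_eq, Real.dist_eq]
  refine Real.sqrt_le_iff.2 ⟨by positivity, ?_⟩
  nlinarith [abs_nonneg (x 0 - y 0), abs_nonneg (x 1 - y 1)]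

end Plane

theorem CodedBy.exists_near {n d : ℕ → ℕ} {l : ℕ} {x : ℝ} (h : CodedBy n d l x) {q : ℕ}
    (hq : 0 < q) (hn : ∀ i, 0 < n i) : ∃ i ∈ Finset.range (q + 1),
      |x - (digitCode n d l + i / q) / (∏ i ∈ Finset.range l, n i : ℕ)| ≤
        1 / (q * (∏ i ∈ Finset.range l, n i : ℕ)) := by
  have hP : (0 : ℝ) < (∏ i ∈ Finset.range l, n i : ℕ) :=
    Nat.cast_pos.2 (Finset.prod_pos fun i _ => hn i)
  unfold CodedBy at h
  generalize ((∏ i ∈ Finset.range l, n i : ℕ) : ℝ) = P at *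
  have hq' : (0 : ℝ) < q := Nat.cast_pos.2 hq
  set t : ℝ := x * P - digitCode n d l with ht
  have h0 : 0 ≤ q * t := mul_nonneg hq'.le (by linarith [h.1])
  -- Round down to the nearest of the `q` subdivisions. The index `q` itself occurs at the right
  -- endpoint `t = 1`, whence `q + 1` candidates.
  refine ⟨⌊q * t⌋₊, ?_, ?_⟩
  · rw [Finset.mem_range, Nat.lt_succ_iff]
    refine Nat.floor_le_of_le ?_
    nlinarith [h.2]
  · have h1 := Nat.floor_le h0
    have h2 := (Nat.lt_floor_add_one (q * t)).le
    have : x - (digitCode n d l + (⌊q * t⌋₊ : ℝ) / q) / P = (q * t - ⌊q * t⌋₊) / (q * P) := by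
      rw [ht]
      field_simp
      ring
    rw [this, abs_div, abs_of_pos (mul_pos hq' hP), abs_of_nonneg (by linarith)]
    gcongr
    linarith

/-- Congruent distinct codes differ by at least `3 * B + 2`. One unit is lost to the width of a
cell, so the points are more than `3 * B` cells apart, and a cell has length `1 / P ≥ 1 / (B * M)`.
-/
theorem lt_abs_sub_of_modEq {a a' B : ℕ} (hne : a ≠ a') (hmod : a % (3 * B + 2) = a' % (3 * B + 2))
    {x x' P M : ℝ} (hM : 0 < M) (hP : 0 < P) (hPM : P ≤ B * M)
    (h1 : a ≤ x * P) (h2 : x * P ≤ a + 1) (h1' : a' ≤ x' * P) (h2' : x' * P ≤ a' + 1) :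
    3 / M < |x - x'| := by
  wlog hlt : a < a' generalizing a a' x x'
  · rw [abs_sub_comm]
    exact this hne.symm hmod.symm h1' h2' h1 h2 (by omega)
  have hge : a + (3 * B + 2) ≤ a' := by
    have hdvd : (3 * B + 2) ∣ a' - a := (Nat.modEq_iff_dvd' hlt.le).1 hmod
    have := Nat.le_of_dvd (by omega) hdvd
    omega
  have hge' : (a : ℝ) + (3 * B + 2) ≤ a' := by exact_mod_cast hge
  have h3 : 3 * (B : ℝ) < (x' - x) * P := by nlinarith
  have h4 : 0 < x' - x := (mul_pos_iff_of_pos_right hP).1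
    (lt_of_le_of_lt (by positivity) h3)
  rw [abs_sub_comm, abs_of_pos h4, div_lt_iff₀ hM]
  have hB : (0 : ℝ) < B := (mul_pos_iff_of_pos_right hM).1 (hP.trans_le hPM)
  nlinarith [mul_le_mul_of_nonneg_left hPM h4.le]

namespace MoranConstruction

variable (A : MoranConstruction)

theorem mProd_le_nProd_ell (k : ℕ) : A.mProd k ≤ A.nProd (A.ell k) := by
  classical
  exact Nat.find_spec (A.exists_mProd_le_nProd k)

theorem mProd_succ (k : ℕ) : A.mProd (k + 1) = A.mProd k * A.m k := Finset.prod_range_succ _ _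

theorem nProd_succ (k : ℕ) : A.nProd (k + 1) = A.nProd k * A.n k := Finset.prod_range_succ _ _

/-- A bound for all the numbers of columns and rows. -/
structure IsBound (B : ℕ) : Prop where
  n_le : ∀ k, A.n k ≤ B
  m_le : ∀ k, A.m k ≤ B

theorem exists_isBound (hN : A.Nplus < ⊤) : ∃ B, A.IsBound B := by
  obtain ⟨B, hB⟩ := ENat.ne_top_iff_exists.1 hN.ne
  have h : ∀ k, max (A.n k : ℕ∞) (A.m k : ℕ∞) ≤ B := fun k => by
    rw [hB]
    exact le_iSup (fun k => max (A.n k : ℕ∞) (A.m k : ℕ∞)) k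
  exact ⟨B, fun k => by exact_mod_cast (le_max_left _ _).trans (h k),
    fun k => by exact_mod_cast (le_max_right _ _).trans (h k)⟩

variable {A}

theorem IsBound.two_le {B : ℕ} (hB : A.IsBound B) : 2 ≤ B := (A.two_le_n 0).trans (hB.n_le 0)

theorem IsBound.mProd_succ_le {B : ℕ} (hB : A.IsBound B) (k : ℕ) :
    A.mProd (k + 1) ≤ B * A.mProd k := by
  rw [mProd_succ, mul_comm]
  exact Nat.mul_le_mul_right _ (hB.m_le k)

theorem IsBound.nProd_ell_le {B : ℕ} (hB : A.IsBound B) (k : ℕ) :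
    A.nProd (A.ell k) ≤ B * A.mProd k := by
  classical
  -- Minimality of `ell` says nothing when `ell k = 0`; there `nProd 0 = 1` suffices.
  rcases hl : A.ell k with _ | l
  · have h1 : 1 ≤ A.mProd k := A.mProd_pos k
    have h2 := hB.two_le
    have : A.nProd 0 = 1 := rfl
    nlinarith
  · have h : A.nProd l < A.mProd k :=
      not_le.1 (Nat.find_min (A.exists_mProd_le_nProd k) (show l < A.ell k by omega))
    rw [nProd_succ, mul_comm]
    exact Nat.mul_le_mul (hB.n_le l) h.le

variable (A)

/-- A grid of `(q + 1) ^ 2` centres in each approximate square comes within `1 / (q * mProd k)` of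
every point in each coordinate. The parameter `q` allows radii a bounded factor smaller than the
square. -/
theorem externalCoveringNumber_le {q : ℕ} (hq : 0 < q) (k : ℕ) {δ : ℝ≥0}
    (hδ : 2 / (q * A.mProd k : ℝ) ≤ δ) :
    Metric.externalCoveringNumber δ A.moranSet ≤ ((q + 1) ^ 2 * A.count (A.ell k) k : ℕ) := by
  have hM : (0 : ℝ) < A.mProd k := Nat.cast_pos.2 (A.mProd_pos k)
  have hMN : (A.mProd k : ℝ) ≤ A.nProd (A.ell k) := by exact_mod_cast A.mProd_le_nProd_ell k
  let c : (ℕ × ℕ) × ℕ × ℕ → Plane := fun z =>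
    !₂[(z.1.1 + z.2.1 / q) / A.nProd (A.ell k), (z.1.2 + z.2.2 / q) / A.mProd k]
  classical
  let C : Finset Plane := (A.rectGrid A.D (A.ell k) k ×ˢ
    (Finset.range (q + 1) ×ˢ Finset.range (q + 1))).image c
  have hC : Metric.IsCover δ A.moranSet (C : Set Plane) := by
    rw [Metric.isCover_iff_subset_iUnion_closedBall]
    intro x hx
    obtain ⟨f, hf, h0, h1⟩ := A.exists_inRectangle hx (A.ell k) k
    obtain ⟨i, hi, hi'⟩ := h0.exists_near hq fun i => two_pos.trans_le (A.two_le_n i)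
    obtain ⟨j, hj, hj'⟩ := h1.exists_near hq fun i => two_pos.trans_le (A.two_le_m i)
    change _ ≤ 1 / ((q : ℝ) * A.nProd (A.ell k)) at hi'
    refine Set.mem_iUnion₂.2 ⟨c ((_, _), i, j), Finset.mem_coe.2 <| Finset.mem_image_of_mem c
      (Finset.mem_product.2 ⟨(A.mem_rectGrid_iff A.nonempty_D).2 ⟨f, hf, rfl, rfl⟩,
        Finset.mem_product.2 ⟨hi, hj⟩⟩), ?_⟩
    rw [Metric.mem_closedBall]
    refine (Plane.dist_le_add _ _).trans (le_trans (add_le_add hi' hj') (le_trans ?_ hδ))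
    have : 1 / ((q : ℝ) * A.nProd (A.ell k)) ≤ 1 / (q * A.mProd k) := by gcongr
    change _ + 1 / ((q : ℝ) * A.mProd k) ≤ _
    calc _ ≤ 1 / ((q : ℝ) * A.mProd k) + 1 / ((q : ℝ) * A.mProd k) := by gcongr
      _ = _ := by ring
  refine hC.externalCoveringNumber_le_encard.trans ?_
  rw [Set.encard_coe_eq_coe_finsetCard]
  refine Nat.cast_le.2 (Finset.card_image_le.trans ?_)
  rw [Finset.card_product, Finset.card_product, card_rectGrid_D, Finset.card_range]
  exact (by ring : _ = _).le

variable {A}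

/-- Points chosen in neighbouring closed rectangles may be close or equal. Keeping only positions in
one residue class modulo `3 * B + 2` in each coordinate separates them, and the best class retains a
proportion `1 / (3 * B + 2) ^ 2`. -/
theorem IsBound.exists_separated {B : ℕ} (hB : A.IsBound B) {g : ℕ → ℕ × ℕ}
    (hg : ∀ i, g i ∈ A.D i) (p k : ℕ) : ∃ S : Finset Plane,
      (∀ x ∈ S, x ∈ A.moranSet ∧ A.InRectangle g p p x) ∧
      (S : Set Plane).Pairwise (fun x y => 3 / (A.mProd k : ℝ) < dist x y) ∧
      A.count (A.ell k) k ≤ (∏ i ∈ Finset.range p, A.r i) * (3 * B + 2) ^ 2 * S.card := by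
  classical
  set G := A.rectGrid (A.prefixDigits g p) (A.ell k) k with hG
  have hpt : ∀ q ∈ G, ∃ x ∈ A.moranSet, A.InRectangle g p p x ∧
      ((q.1 : ℝ) ≤ x 0 * A.nProd (A.ell k) ∧ x 0 * A.nProd (A.ell k) ≤ q.1 + 1) ∧
      (q.2 : ℝ) ≤ x 1 * A.mProd k ∧ x 1 * A.mProd k ≤ q.2 + 1 := by
    intro q hq
    obtain ⟨f, hf, h1, h2⟩ := (A.mem_rectGrid_iff (A.nonempty_prefixDigits g p)).1 hq
    obtain ⟨x, hx, hx'⟩ := A.exists_mem_moranSet fun i => A.prefixDigits_subset hg p i (hf i)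
    have hfg : ∀ i < p, f i = g i := fun i hi => by
      simpa [prefixDigits, hi] using hf i
    refine ⟨x, hx, ⟨(hx' p p).1.congr fun i hi => by rw [hfg i hi],
      (hx' p p).2.congr fun i hi => by rw [hfg i hi]⟩, ?_⟩
    rw [← h1, ← h2]
    exact hx' (A.ell k) k
  choose! pt hptE hptp hpt0 hpt1 using hpt
  set Q := 3 * B + 2 with hQ
  let T : Finset (ℕ × ℕ) := Finset.range Q ×ˢ Finset.range Q
  have hT : T.card = Q ^ 2 := by simp [T, sq]
  have hTpos : (0 : ℝ) < T.card := by
    rw [hT]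
    positivity
  -- Pigeonhole: some residue class `y` contains at least the average number of positions.
  obtain ⟨y, -, hy⟩ := Finset.exists_le_card_fiber_of_nsmul_le_card_of_maps_to
    (s := G) (t := T) (f := fun q => (q.1 % Q, q.2 % Q)) (b := (G.card : ℝ) / T.card)
    (fun q _ => by simp [T, Nat.mod_lt _ (show 0 < Q by omega)])
    (Finset.card_pos.1 (by exact_mod_cast hTpos))
    (by rw [nsmul_eq_mul, mul_div_cancel₀ _ hTpos.ne'])
  set H := G.filter fun q => (q.1 % Q, q.2 % Q) = y with hH
  have hM : (0 : ℝ) < A.mProd k := Nat.cast_pos.2 (A.mProd_pos k)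
  have hMN : (0 : ℝ) < A.nProd (A.ell k) := Nat.cast_pos.2 (A.nProd_pos _)
  have hNB : (A.nProd (A.ell k) : ℝ) ≤ B * A.mProd k := by exact_mod_cast hB.nProd_ell_le k
  have hMB : (A.mProd k : ℝ) ≤ B * A.mProd k := by
    have : (2 : ℝ) ≤ B := by exact_mod_cast hB.two_le
    nlinarith
  have hsep : ∀ q ∈ H, ∀ q' ∈ H, q ≠ q' → 3 / (A.mProd k : ℝ) < dist (pt q) (pt q') := by
    intro q hq q' hq' hne
    rw [hH, Finset.mem_filter] at hq hq'
    have hmod := hq.2.trans hq'.2.symm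
    rw [Prod.mk.injEq] at hmod
    by_cases h : q.1 = q'.1
    · have h' : q.2 ≠ q'.2 := fun h' => hne (Prod.ext h h')
      exact (lt_abs_sub_of_modEq h' hmod.2 hM hM hMB (hpt1 q hq.1).1 (hpt1 q hq.1).2
        (hpt1 q' hq'.1).1 (hpt1 q' hq'.1).2).trans_le (Plane.abs_sub_apply_le_dist _ _ 1)
    · exact (lt_abs_sub_of_modEq h hmod.1 hM hMN hNB (hpt0 q hq.1).1 (hpt0 q hq.1).2
        (hpt0 q' hq'.1).1 (hpt0 q' hq'.1).2).trans_le (Plane.abs_sub_apply_le_dist _ _ 0)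
  have hinj : Set.InjOn pt H := by
    intro q hq q' hq' heq
    by_contra hne
    have := hsep q hq q' hq' hne
    rw [heq, dist_self] at this
    exact absurd this (not_lt.2 (by positivity))
  refine ⟨H.image pt, ?_, ?_, ?_⟩
  · intro x hx
    obtain ⟨q, hq, rfl⟩ := Finset.mem_image.1 hx
    have := (Finset.mem_filter.1 hq).1
    exact ⟨hptE q this, hptp q this⟩
  · intro x hx x' hx' hne
    obtain ⟨q, hq, rfl⟩ := Finset.mem_image.1 (Finset.mem_coe.1 hx)
    obtain ⟨q', hq', rfl⟩ := Finset.mem_image.1 (Finset.mem_coe.1 hx')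
    exact hsep q hq q' hq' fun h => hne (by rw [h])
  · rw [Finset.card_image_of_injOn hinj, mul_assoc]
    refine (A.count_le_mul_card_rectGrid hg p (A.ell k) k).trans (Nat.mul_le_mul_left _ ?_)
    rw [div_le_iff₀ hTpos, hT] at hy
    rw [mul_comm]
    exact_mod_cast hy

theorem IsBound.count_le_mul_externalCoveringNumber {B : ℕ} (hB : A.IsBound B) (k : ℕ) {δ : ℝ≥0}
    (hδ : (δ : ℝ) ≤ 1 / A.mProd k) :
    (A.count (A.ell k) k : ℕ∞) ≤
      ((3 * B + 2) ^ 2 : ℕ) * Metric.externalCoveringNumber δ A.moranSet := by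
  choose g hg using A.nonempty_D
  -- With `p = 0` no digit is prescribed, so `g` is irrelevant and the constant is `(3 * B + 2) ^
  -- 2`.
  obtain ⟨S, hSE, hS, hcard⟩ := hB.exists_separated hg 0 k
  have hsep : Metric.IsSeparated ((2 * δ : ℝ≥0) : ℝ≥0∞) (S : Set Plane) := by
    intro x hx y hy hxy
    have h1 := hS hx hy hxy
    rw [edist_nndist, ENNReal.coe_lt_coe, ← NNReal.coe_lt_coe, coe_nndist]
    push_cast
    refine lt_of_le_of_lt ?_ h1
    calc 2 * (δ : ℝ) ≤ 3 * δ := by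
          nlinarith [NNReal.coe_nonneg δ]
      _ ≤ 3 * (1 / A.mProd k) := by gcongr
      _ = _ := by ring
  have hle := (hsep.encard_le_packingNumber fun x hx => (hSE x hx).1).trans
    (Metric.packingNumber_two_mul_le_externalCoveringNumber δ A.moranSet)
  rw [Set.encard_coe_eq_coe_finsetCard] at hle
  calc (A.count (A.ell k) k : ℕ∞) ≤ (((3 * B + 2) ^ 2 * S.card : ℕ) : ℕ∞) := by
        exact_mod_cast (by simpa using hcard)
    _ ≤ _ := by
        push_cast
        gcongr

end MoranConstruction

/-! ### Box-counting dimensions -/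

theorem tendsto_coe_ereal_zero {α : Type*} {l : Filter α} {u : α → ℝ} (h : Tendsto u l (𝓝 0)) :
    Tendsto (fun a => (u a : EReal)) l (𝓝 0) :=
  (continuous_coe_real_ereal.tendsto 0).comp h

theorem limsup_coe_le_of_tendsto_sub {α : Type*} {l : Filter α} [l.NeBot] {u v : α → ℝ}
    (h : Tendsto (fun a => u a - v a) l (𝓝 0)) :
    limsup (fun a => (u a : EReal)) l ≤ limsup (fun a => (v a : EReal)) l := by
  have h0 : limsup (fun a => ((u a - v a : ℝ) : EReal)) l = 0 :=
    (tendsto_coe_ereal_zero h).limsup_eq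
  have huv : (fun a => (u a : EReal)) =
      (fun a => (v a : EReal)) + fun a => ((u a - v a : ℝ) : EReal) := by
    ext a
    rw [Pi.add_apply, ← EReal.coe_add]
    congr 1
    ring
  rw [huv]
  refine (EReal.limsup_add_le (Or.inr ?_) (Or.inr ?_)).trans ?_ <;> rw [h0] <;> simp

theorem liminf_coe_le_of_tendsto_sub {α : Type*} {l : Filter α} [l.NeBot] {u v : α → ℝ}
    (h : Tendsto (fun a => u a - v a) l (𝓝 0)) :
    liminf (fun a => (v a : EReal)) l ≤ liminf (fun a => (u a : EReal)) l := by
  have h0 : liminf (fun a => ((u a - v a : ℝ) : EReal)) l = 0 :=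
    (tendsto_coe_ereal_zero h).liminf_eq
  have huv : (fun a => (u a : EReal)) =
      (fun a => (v a : EReal)) + fun a => ((u a - v a : ℝ) : EReal) := by
    ext a
    rw [Pi.add_apply, ← EReal.coe_add]
    congr 1
    ring
  rw [huv]
  refine le_trans ?_ EReal.le_liminf_add
  rw [h0, add_zero]

theorem tendsto_sub_swap {α : Type*} {l : Filter α} {u v : α → ℝ}
    (h : Tendsto (fun a => u a - v a) l (𝓝 0)) : Tendsto (fun a => v a - u a) l (𝓝 0) := by
  simpa using h.neg

namespace MoranConstruction

variable (A : MoranConstruction)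

/-! ### Passing between the scale `δ` and the level `k` -/

theorem two_pow_le_mProd (k : ℕ) : 2 ^ k ≤ A.mProd k := by
  calc 2 ^ k = ∏ _i ∈ Finset.range k, 2 := by simp
    _ ≤ A.mProd k := Finset.prod_le_prod' fun i _ => A.two_le_m i

theorem mProd_mono : Monotone A.mProd := monotone_nat_of_le_succ fun k => by
  rw [mProd_succ]
  exact Nat.le_mul_of_pos_right _ (two_pos.trans_le (A.two_le_m k))

theorem mProd_lt_succ (k : ℕ) : A.mProd k < A.mProd (k + 1) := by
  rw [mProd_succ]
  have := A.two_le_m k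
  have := A.mProd_pos k
  nlinarith

theorem exists_lt_mProd_succ (x : ℝ) : ∃ k, x < A.mProd (k + 1) := by
  obtain ⟨k, hk⟩ := pow_unbounded_of_one_lt x one_lt_two
  refine ⟨k, hk.trans_le ?_⟩
  have := (A.two_pow_le_mProd k).trans (A.mProd_mono k.le_succ)
  exact_mod_cast this

open Classical in
/-- The level whose rectangles have size comparable to `δ`. -/
noncomputable def level (δ : ℝ) : ℕ := Nat.find (A.exists_lt_mProd_succ (1 / δ))

theorem lt_of_level {δ : ℝ} (hδ : 0 < δ) : 1 / (A.mProd (A.level δ + 1) : ℝ) < δ := by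
  classical
  have h : 1 / δ < A.mProd (A.level δ + 1) := Nat.find_spec (A.exists_lt_mProd_succ (1 / δ))
  rwa [one_div_lt hδ (Nat.cast_pos.2 (A.mProd_pos _))] at h

theorem le_of_level {δ : ℝ} (hδ : 0 < δ) (hδ1 : δ ≤ 1) : δ ≤ 1 / (A.mProd (A.level δ) : ℝ) := by
  classical
  rw [le_one_div hδ (Nat.cast_pos.2 (A.mProd_pos _))]
  rcases hl : A.level δ with _ | l
  · simpa [mProd] using (one_le_div hδ).2 hδ1
  · exact not_lt.1 (Nat.find_min (A.exists_lt_mProd_succ (1 / δ)) (show l < A.level δ by omega))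

theorem le_level {δ : ℝ} (hδ : 0 < δ) {k : ℕ} (h : δ ≤ 1 / (A.mProd k : ℝ)) : k ≤ A.level δ := by
  by_contra! hlt
  have h1 := (A.lt_of_level hδ).trans_le h
  rw [one_div_lt_one_div (Nat.cast_pos.2 (A.mProd_pos _)) (Nat.cast_pos.2 (A.mProd_pos _)),
    Nat.cast_lt] at h1
  exact absurd h1 (not_lt.2 (A.mProd_mono hlt))

theorem level_one_div (k : ℕ) : A.level (1 / A.mProd k) = k := by
  have hM := Nat.cast_pos (α := ℝ).2 (A.mProd_pos k)
  refine le_antisymm ?_ (A.le_level (by positivity) le_rfl)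
  by_contra! hlt
  have hle : (1 : ℝ) / A.mProd k ≤ 1 := by
    rw [div_le_one hM]
    exact_mod_cast A.mProd_pos k
  have h1 := A.le_of_level (by positivity) hle
  rw [one_div_le_one_div hM (Nat.cast_pos.2 (A.mProd_pos _)), Nat.cast_le] at h1
  exact absurd ((A.mProd_lt_succ k).trans_le (A.mProd_mono hlt)) (not_lt.2 h1)

theorem tendsto_mProd : Tendsto (fun k => (A.mProd k : ℝ)) atTop atTop :=
  tendsto_natCast_atTop_atTop.comp <|
    tendsto_atTop_mono A.two_pow_le_mProd (tendsto_pow_atTop_atTop_of_one_lt one_lt_two)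

theorem tendsto_one_div_mProd :
    Tendsto (fun k => (1 / A.mProd k : ℝ)) atTop (𝓝 0) := by
  simp_rw [one_div]
  exact A.tendsto_mProd.inv_tendsto_atTop

/-- Equality of filters, not just convergence, turns upper and lower limits over `k` into ones over
`δ`. The reverse inequality holds because `1 / mProd k` tends to 0 and has level exactly `k`. -/
theorem map_level : map (fun δ : ℝ≥0 => A.level δ) (𝓝[>] 0) = atTop := by
  refine le_antisymm (tendsto_atTop.2 fun k => ?_) ?_
  · have hM := Nat.cast_pos (α := ℝ≥0).2 (A.mProd_pos k)
    have : Set.Ioo (0 : ℝ≥0) (1 / A.mProd k) ∈ 𝓝[>] (0 : ℝ≥0) :=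
      Ioo_mem_nhdsGT (by positivity)
    filter_upwards [this] with δ hδ
    refine A.le_level (NNReal.coe_pos.2 hδ.1) ?_
    have := NNReal.coe_le_coe.2 hδ.2.le
    simpa using this
  · have h : Tendsto (fun k => (1 / A.mProd k : ℝ≥0)) atTop (𝓝[>] 0) := by
      refine tendsto_nhdsWithin_iff.2 ⟨?_, Eventually.of_forall fun k => ?_⟩
      · rw [← NNReal.tendsto_coe]
        simpa using A.tendsto_one_div_mProd
      · have hM := Nat.cast_pos (α := ℝ≥0).2 (A.mProd_pos k)
        exact div_pos one_pos hM
    have hid : (fun δ : ℝ≥0 => A.level δ) ∘ (fun k => (1 / A.mProd k : ℝ≥0)) = id := by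
      ext k
      simpa using A.level_one_div k
    calc (atTop : Filter ℕ) = map ((fun δ : ℝ≥0 => A.level δ) ∘ fun k => (1 / A.mProd k : ℝ≥0))
          atTop := by rw [hid, map_id]
      _ ≤ _ := by
        rw [← map_map]
        exact map_mono h

theorem tendsto_level : Tendsto (fun δ : ℝ≥0 => A.level δ) (𝓝[>] 0) atTop := A.map_level.le

/-- The covering number of the Moran set, as a natural number. -/
noncomputable def coverNum (δ : ℝ≥0) : ℕ :=
  (Metric.externalCoveringNumber δ A.moranSet).toNat

theorem nonempty_moranSet : A.moranSet.Nonempty := by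
  choose g hg using A.nonempty_D
  obtain ⟨x, hx, -⟩ := A.exists_mem_moranSet hg
  exact ⟨x, hx⟩

variable {A}

theorem IsBound.two_div_le {B : ℕ} (hB : A.IsBound B) {c : ℕ} (hc : 0 < c) (k : ℕ) :
    2 / (((2 * c * B : ℕ) : ℝ) * A.mProd k) ≤ 1 / A.mProd (k + 1) / c := by
  have hM := Nat.cast_pos (α := ℝ).2 (A.mProd_pos (k + 1))
  have h2 : (A.mProd (k + 1) : ℝ) ≤ B * A.mProd k := by exact_mod_cast hB.mProd_succ_le _
  have hc' : (0 : ℝ) < c := Nat.cast_pos.2 hc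
  calc 2 / (((2 * c * B : ℕ) : ℝ) * A.mProd k) = 1 / (B * A.mProd k) / c := by
        push_cast
        field_simp
    _ ≤ 1 / A.mProd (k + 1) / c := by gcongr

theorem IsBound.coverNum_spec {B : ℕ} (hB : A.IsBound B) {δ : ℝ≥0} (hδ : 0 < δ) :
    Metric.externalCoveringNumber δ A.moranSet = A.coverNum δ ∧
    A.coverNum δ ≤ (2 * B + 1) ^ 2 * A.count (A.ell (A.level δ)) (A.level δ) := by
  have hB2 := hB.two_le
  have h := A.externalCoveringNumber_le (q := 2 * B) (by omega) (A.level δ) (δ := δ)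
    (le_trans (by simpa using hB.two_div_le one_pos (A.level δ))
      (A.lt_of_level (NNReal.coe_pos.2 hδ)).le)
  refine ⟨(ENat.natCast_toNat (h.trans_lt (ENat.natCast_lt_top _)).ne).symm, ENat.toNat_le_of_le_natCast h⟩

theorem IsBound.count_le_mul_coverNum {B : ℕ} (hB : A.IsBound B) {δ : ℝ≥0} (hδ : 0 < δ)
    (hδ1 : δ ≤ 1) : A.count (A.ell (A.level δ)) (A.level δ) ≤ (3 * B + 2) ^ 2 * A.coverNum δ := by
  have h := hB.count_le_mul_externalCoveringNumber (A.level δ) (δ := δ)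
    (A.le_of_level (NNReal.coe_pos.2 hδ) (by exact_mod_cast hδ1))
  rw [(hB.coverNum_spec hδ).1] at h
  exact_mod_cast h

theorem IsBound.boxRatio_eq {B : ℕ} (hB : A.IsBound B) {δ : ℝ≥0} (hδ : 0 < δ) (hδ1 : δ ≤ 1) :
    Plane.boxRatio A.moranSet δ = ((Real.log (A.coverNum δ) / -Real.log δ : ℝ) : EReal) := by
  have hpos : 0 < A.coverNum δ := by
    have h1 := A.count_pos (A.ell (A.level δ)) (A.level δ)
    have h2 := hB.count_le_mul_coverNum hδ hδ1
    by_contra h0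
    simp [Nat.eq_zero_of_not_pos h0] at h2
    omega
  rw [Plane.boxRatio, (hB.coverNum_spec hδ).1, EReal.coe_div]
  congr 1
  rw [ENNReal.log_pos_real] <;> simp [hpos.ne']

theorem log_mProd_pos {k : ℕ} (hk : 1 ≤ k) : Real.log 2 ≤ Real.log (A.mProd k) := by
  refine Real.log_le_log two_pos ?_
  have : 2 ^ 1 ≤ A.mProd k := (Nat.pow_le_pow_right two_pos hk).trans (A.two_pow_le_mProd k)
  exact_mod_cast this

theorem dimRatio_nonneg (k : ℕ) : 0 ≤ A.dimRatio k :=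
  div_nonneg (Real.log_natCast_nonneg _) (Real.log_natCast_nonneg _)

theorem IsBound.dimRatio_le {B : ℕ} (hB : A.IsBound B) {k : ℕ} (hk : 1 ≤ k) :
    A.dimRatio k ≤ Real.log B / Real.log 2 + 2 := by
  have h2 : 0 < Real.log 2 := Real.log_pos one_lt_two
  have hM := log_mProd_pos (A := A) hk
  have hM0 := h2.trans_le hM
  have hMpos := Nat.cast_pos (α := ℝ).2 (A.mProd_pos k)
  have hBpos : (0 : ℝ) < B := Nat.cast_pos.2 (two_pos.trans_le hB.two_le)
  have hc : (A.count (A.ell k) k : ℝ) ≤ B * A.mProd k * A.mProd k := by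
    exact_mod_cast (A.count_le _ _).trans (Nat.mul_le_mul_right _ (hB.nProd_ell_le k))
  have hcpos := Nat.cast_pos (α := ℝ).2 (A.count_pos (A.ell k) k)
  rw [dimRatio, div_le_iff₀ hM0]
  calc Real.log (A.count (A.ell k) k) ≤ Real.log (B * A.mProd k * A.mProd k) :=
        Real.log_le_log hcpos hc
    _ = Real.log B / Real.log 2 * Real.log 2 + 2 * Real.log (A.mProd k) := by
        rw [Real.log_mul (by positivity) hMpos.ne', Real.log_mul hBpos.ne' hMpos.ne']
        field_simp
        ring
    _ ≤ Real.log B / Real.log 2 * Real.log (A.mProd k) + 2 * Real.log (A.mProd k) := by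
        have : 0 ≤ Real.log B := Real.log_natCast_nonneg _
        gcongr
    _ = _ := by ring

/-- The numerators of the two ratios differ by at most `C`, their denominators by at most `log B`,
and `dimRatio` is bounded by `G`; so the error is at most `(C + G * log B) / -log δ`. -/
theorem IsBound.tendsto_boxRatio_sub {B : ℕ} (hB : A.IsBound B) :
    Tendsto (fun δ : ℝ≥0 => Real.log (A.coverNum δ) / -Real.log δ - A.dimRatio (A.level δ))
      (𝓝[>] 0) (𝓝 0) := by
  have hlog : Tendsto (fun δ : ℝ≥0 => -Real.log δ) (𝓝[>] 0) atTop := by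
    refine tendsto_neg_atBot_atTop.comp (Real.tendsto_log_nhdsGT_zero.comp ?_)
    refine tendsto_nhdsWithin_iff.2 ⟨?_, ?_⟩
    · exact (NNReal.continuous_coe.tendsto 0).mono_left nhdsWithin_le_nhds
    · filter_upwards [self_mem_nhdsWithin] with δ hδ
      exact NNReal.coe_pos.2 hδ
  set G := Real.log B / Real.log 2 + 2
  set C := Real.log ((3 * B + 2 : ℝ) ^ 2)
  refine squeeze_zero_norm' (a := fun δ : ℝ≥0 => (C + G * Real.log B) / -Real.log δ) ?_
    (hlog.const_div_atTop _)
  have hIoo : Set.Ioo (0 : ℝ≥0) 1 ∈ 𝓝[>] (0 : ℝ≥0) := Ioo_mem_nhdsGT one_pos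
  filter_upwards [hIoo, A.tendsto_level.eventually_ge_atTop 1] with δ hδ hk
  have hδ0 : (0 : ℝ) < δ := NNReal.coe_pos.2 hδ.1
  have hδ1 : (δ : ℝ) < 1 := by exact_mod_cast hδ.2
  have hL : 0 < -Real.log δ := neg_pos.2 (Real.log_neg hδ0 hδ1)
  have hcN := hB.count_le_mul_coverNum hδ.1 hδ.2.le
  have hNc := (hB.coverNum_spec hδ.1).2
  have h1 := A.lt_of_level hδ0
  have h2 := A.le_of_level hδ0 hδ1.le
  have hG := hB.dimRatio_le hk
  have hG0 := A.dimRatio_nonneg (A.level δ)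
  have hlM := (Real.log_pos one_lt_two).trans_le (log_mProd_pos (A := A) hk)
  have hsucc := hB.mProd_succ_le (A.level δ)
  have hc := A.count_pos (A.ell (A.level δ)) (A.level δ)
  have hdim : A.dimRatio (A.level δ) * Real.log (A.mProd (A.level δ)) =
      Real.log (A.count (A.ell (A.level δ)) (A.level δ)) := div_mul_cancel₀ _ hlM.ne'
  generalize A.level δ = k at *
  generalize A.count (A.ell k) k = c at *
  have hN : 0 < A.coverNum δ := Nat.pos_of_ne_zero fun h => by
    rw [h] at hcN
    omega
  generalize A.coverNum δ = N at *
  have hMpos := Nat.cast_pos (α := ℝ).2 (A.mProd_pos k)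
  have hMpos' := Nat.cast_pos (α := ℝ).2 (A.mProd_pos (k + 1))
  have hB0 : (0 : ℝ) < B := Nat.cast_pos.2 (two_pos.trans_le hB.two_le)
  have hc0 : (0 : ℝ) < c := Nat.cast_pos.2 hc
  have hN0 : (0 : ℝ) < N := Nat.cast_pos.2 hN
  have hlB : 0 ≤ Real.log B := Real.log_natCast_nonneg _
  have e1 : Real.log (A.mProd k) ≤ -Real.log δ := by
    rw [← Real.log_inv]
    refine Real.log_le_log hMpos ?_
    rw [le_inv_comm₀ hMpos hδ0]
    simpa using h2
  have e2 : -Real.log δ ≤ Real.log B + Real.log (A.mProd k) := by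
    rw [← Real.log_mul hB0.ne' hMpos.ne', ← Real.log_inv]
    refine Real.log_le_log (inv_pos.2 hδ0) ?_
    have : (A.mProd (k + 1) : ℝ) ≤ B * A.mProd k := by exact_mod_cast hsucc
    refine le_trans ?_ this
    rw [inv_le_comm₀ hδ0 hMpos']
    simpa using h1.le
  have e3 : Real.log N ≤ C + Real.log c := by
    rw [← Real.log_mul (by positivity) hc0.ne']
    refine Real.log_le_log hN0 ?_
    calc (N : ℝ) ≤ (2 * B + 1) ^ 2 * c := by exact_mod_cast hNc
      _ ≤ _ := by
        gcongr <;> norm_num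
  have e4 : Real.log c ≤ C + Real.log N := by
    rw [← Real.log_mul (by positivity) hN0.ne']
    refine Real.log_le_log hc0 ?_
    exact_mod_cast hcN
  -- This separates the error in the numerator from the error in the denominator.
  have hform : Real.log N / -Real.log δ - A.dimRatio k =
      ((Real.log N - Real.log c) - A.dimRatio k * (-Real.log δ - Real.log (A.mProd k))) /
        -Real.log δ := by
    rw [mul_sub, hdim, eq_div_iff hL.ne', sub_mul, div_mul_cancel₀ _ hL.ne']
    ring
  rw [hform, Real.norm_eq_abs, abs_div, abs_of_pos hL]
  gcongr
  have e5 : A.dimRatio k * (-Real.log δ - Real.log (A.mProd k)) ≤ G * Real.log B :=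
    mul_le_mul hG (by linarith) (by linarith) (hG0.trans hG)
  have e6 : 0 ≤ A.dimRatio k * (-Real.log δ - Real.log (A.mProd k)) :=
    mul_nonneg hG0 (by linarith)
  rw [abs_le]
  constructor <;> linarith

theorem IsBound.boxRatio_eventuallyEq {B : ℕ} (hB : A.IsBound B) :
    Plane.boxRatio A.moranSet =ᶠ[𝓝[>] 0]
      fun δ : ℝ≥0 => ((Real.log (A.coverNum δ) / -Real.log δ : ℝ) : EReal) := by
  have hIoo : Set.Ioo (0 : ℝ≥0) 1 ∈ 𝓝[>] (0 : ℝ≥0) := Ioo_mem_nhdsGT one_pos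
  filter_upwards [hIoo] with δ hδ
  exact hB.boxRatio_eq hδ.1 hδ.2.le

theorem IsBound.upperBoxDim_eq {B : ℕ} (hB : A.IsBound B) :
    Plane.upperBoxDim A.moranSet = A.dUpper := by
  have h : A.dUpper = limsup (fun δ : ℝ≥0 => (A.dimRatio (A.level δ) : EReal)) (𝓝[>] 0) := by
    rw [dUpper, ← A.map_level]
    rfl
  rw [Plane.upperBoxDim, limsup_congr hB.boxRatio_eventuallyEq, h]
  exact le_antisymm (limsup_coe_le_of_tendsto_sub hB.tendsto_boxRatio_sub)
    (limsup_coe_le_of_tendsto_sub (tendsto_sub_swap hB.tendsto_boxRatio_sub))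

theorem IsBound.lowerBoxDim_eq {B : ℕ} (hB : A.IsBound B) :
    Plane.lowerBoxDim A.moranSet = A.dLower := by
  have h : A.dLower = liminf (fun δ : ℝ≥0 => (A.dimRatio (A.level δ) : EReal)) (𝓝[>] 0) := by
    rw [dLower, ← A.map_level]
    rfl
  rw [Plane.lowerBoxDim, liminf_congr hB.boxRatio_eventuallyEq, h]
  exact le_antisymm (liminf_coe_le_of_tendsto_sub (tendsto_sub_swap hB.tendsto_boxRatio_sub))
    (liminf_coe_le_of_tendsto_sub hB.tendsto_boxRatio_sub)

end MoranConstruction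

/-! ### Packing dimension -/

namespace Plane

theorem packingPreMeasure_empty (s : ℝ≥0) : packingPreMeasure s ∅ = 0 := by
  refine le_antisymm (iInf₂_le_of_le 1 one_pos (iSup₂_le fun P hP => ?_)) zero_le
  have : P = ∅ := Finset.eq_empty_of_forall_notMem fun b hb => (hP.1 b hb).1
  simp [this]

theorem packingMeasure_le_packingPreMeasure (s : ℝ≥0) (F : Set Plane) :
    packingMeasure s F ≤ packingPreMeasure s F := by
  let G : ℕ → Set Plane := fun i => if i = 0 then F else ∅
  refine iInf₂_le_of_le G (Set.subset_iUnion_of_subset 0 (by simp [G])) ?_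
  rw [tsum_eq_single 0 fun i hi => by simp [G, hi, packingPreMeasure_empty]]
  simp [G]

end Plane

theorem CodedBy.abs_sub_le {n d : ℕ → ℕ} {k : ℕ} {x y : ℝ} (hx : CodedBy n d k x)
    (hy : CodedBy n d k y) (h : 2 ^ k ≤ ∏ i ∈ Finset.range k, n i) :
    |x - y| ≤ (1 / 2) ^ k := by
  unfold CodedBy at hx hy
  have h' : (2 : ℝ) ^ k ≤ (∏ i ∈ Finset.range k, n i : ℕ) := by exact_mod_cast h
  have hP := (pow_pos (two_pos (α := ℝ)) k).trans_le h'
  generalize ((∏ i ∈ Finset.range k, n i : ℕ) : ℝ) = P at *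
  calc |x - y| ≤ 1 / P := by
        have h1 : |(x - y) * P| ≤ 1 := by
          rw [abs_le]
          constructor <;> linarith
        have h2 : |(x - y) * P| = |x - y| * P := by rw [abs_mul, abs_of_pos hP]
        rwa [le_div_iff₀ hP, ← h2]
    _ ≤ 1 / 2 ^ k := by gcongr
    _ = _ := by rw [one_div_pow]

namespace MoranConstruction

variable {A : MoranConstruction}

/-! ### Upper bound for the packing dimension -/

/-- Disjoint balls of radius above `1 / mProd (k + 1)` have centres that far apart, so no ball of
half that radius contains two of them; covering with `q = 4 * B` bounds their number. -/
theorem IsBound.card_packing_level_le {B : ℕ} (hB : A.IsBound B) {δ : ℝ}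
    {P : Finset (Plane × ℝ)} (hP : Plane.IsPacking A.moranSet δ P) (k : ℕ) :
    (P.filter fun b => A.level b.2 = k).card ≤ (4 * B + 1) ^ 2 * A.count (A.ell k) k := by
  classical
  set H := P.filter fun b => A.level b.2 = k with hH
  have hM := Nat.cast_pos (α := ℝ≥0).2 (A.mProd_pos (k + 1))
  set ε : ℝ≥0 := 1 / A.mProd (k + 1) / 2 with hε
  have hsep : ∀ b ∈ H, ∀ b' ∈ H, b ≠ b' → (1 / A.mProd (k + 1) : ℝ) < dist b.1 b'.1 := by
    intro b hb b' hb' hne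
    rw [hH, Finset.mem_filter] at hb hb'
    have h1 := A.lt_of_level (hP.1 b hb.1).2.1
    rw [hb.2] at h1
    have h2 : b'.1 ∉ Metric.closedBall b.1 b.2 := fun h =>
      Set.disjoint_left.1 (hP.2 hb.1 hb'.1 hne) h
        (Metric.mem_closedBall_self (hP.1 b' hb'.1).2.1.le)
    rw [Metric.mem_closedBall, not_le, dist_comm] at h2
    exact h1.trans h2
  have hinj : Set.InjOn Prod.fst (H : Set (Plane × ℝ)) := by
    intro b hb b' hb' heq
    by_contra hne
    have := hsep b hb b' hb' hne
    rw [heq, dist_self] at this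
    exact absurd this (not_lt.2 (by positivity))
  have hS : Metric.IsSeparated ((2 * ε : ℝ≥0) : ℝ≥0∞) (H.image Prod.fst : Set Plane) := by
    intro x hx y hy hxy
    obtain ⟨b, hb, rfl⟩ := Finset.mem_image.1 (Finset.mem_coe.1 hx)
    obtain ⟨b', hb', rfl⟩ := Finset.mem_image.1 (Finset.mem_coe.1 hy)
    have h1 := hsep b hb b' hb' fun h => hxy (by rw [h])
    rw [edist_nndist, ENNReal.coe_lt_coe, ← NNReal.coe_lt_coe, coe_nndist, hε,
      mul_div_cancel₀ _ two_ne_zero]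
    simpa using h1
  have hle := (hS.encard_le_packingNumber fun x hx => by
    obtain ⟨b, hb, rfl⟩ := Finset.mem_image.1 (Finset.mem_coe.1 hx)
    exact (hP.1 b (Finset.mem_filter.1 hb).1).1).trans
    (Metric.packingNumber_two_mul_le_externalCoveringNumber ε A.moranSet)
  rw [Set.encard_coe_eq_coe_finsetCard, Finset.card_image_of_injOn hinj] at hle
  have hB2 := hB.two_le
  have hcov := A.externalCoveringNumber_le (q := 2 * 2 * B) (by omega) k (δ := ε) (by
    simpa [hε] using hB.two_div_le two_pos k)
  exact Nat.cast_le.1 (hle.trans hcov)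

theorem IsBound.packingMeasure_ne_top {B : ℕ} (hB : A.IsBound B) {s : ℝ≥0} {t : ℝ} (hts : t < s)
    (ht : ∀ᶠ k in atTop, (A.count (A.ell k) k : ℝ) ≤ (A.mProd k : ℝ) ^ t) :
    Plane.packingMeasure s A.moranSet ≠ ⊤ := by
  classical
  obtain ⟨k₀, hk₀⟩ := eventually_atTop.1 ht
  have hM : ∀ k, (0 : ℝ) < A.mProd k := fun k => Nat.cast_pos.2 (A.mProd_pos k)
  have hδ1 : (1 / A.mProd k₀ : ℝ) ≤ 1 := by
    rw [div_le_one (hM _)]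
    exact_mod_cast A.mProd_pos k₀
  set C : ℝ := (4 * B + 1) ^ 2 * 2 ^ (s : ℝ)
  set ρ : ℝ := 2 ^ (t - s)
  -- The ratio `ρ` arises from `mProd k ≥ 2 ^ k` and the negative exponent `t - s`.
  have hρ : 0 ≤ ρ := by positivity
  have hρ1 : ρ < 1 := Real.rpow_lt_one_of_one_lt_of_neg one_lt_two (by linarith)
  have hsum : Summable fun k : ℕ => C * ρ ^ k := (summable_geometric_of_lt_one hρ hρ1).mul_left C
  have hlevel : ∀ k, k₀ ≤ k → (A.count (A.ell k) k : ℝ) * (2 * (1 / A.mProd k)) ^ (s : ℝ) ≤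
      2 ^ (s : ℝ) * ρ ^ k := fun k hk => by
    calc (A.count (A.ell k) k : ℝ) * (2 * (1 / A.mProd k)) ^ (s : ℝ)
        ≤ (A.mProd k : ℝ) ^ t * (2 * (1 / A.mProd k)) ^ (s : ℝ) := by
          gcongr
          exact hk₀ k hk
      _ = 2 ^ (s : ℝ) * (A.mProd k : ℝ) ^ (t - s) := by
          rw [Real.mul_rpow two_pos.le (by positivity), one_div, Real.inv_rpow (hM k).le,
            Real.rpow_sub (hM k)]
          ring
      _ ≤ 2 ^ (s : ℝ) * ((2 : ℝ) ^ k) ^ (t - s) := by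
          gcongr 2 ^ (s : ℝ) * ?_
          refine Real.rpow_le_rpow_of_nonpos (by positivity) ?_ (by linarith)
          exact_mod_cast A.two_pow_le_mProd k
      _ = 2 ^ (s : ℝ) * ρ ^ k := by
          rw [← Real.rpow_natCast, ← Real.rpow_natCast, ← Real.rpow_mul two_pos.le,
            ← Real.rpow_mul two_pos.le, mul_comm (k : ℝ)]
  have hbound : ∀ P : Finset (Plane × ℝ), Plane.IsPacking A.moranSet (1 / A.mProd k₀) P →
      ∑ b ∈ P, (2 * b.2) ^ (s : ℝ) ≤ ∑' k : ℕ, C * ρ ^ k := by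
    intro P hP
    rw [← Finset.sum_fiberwise_of_maps_to (g := fun b => A.level b.2)
      (t := P.image fun b => A.level b.2) fun b hb => Finset.mem_image_of_mem _ hb]
    set I := P.image fun b => A.level b.2
    have hI : ∑ k ∈ I, C * ρ ^ k ≤ ∑' k : ℕ, C * ρ ^ k :=
      hsum.sum_le_tsum I fun k _ => by positivity
    refine (Finset.sum_le_sum fun k hk => ?_).trans hI
    have hkk : k₀ ≤ k := by
      obtain ⟨b, hb, rfl⟩ := Finset.mem_image.1 hk
      exact A.le_level (hP.1 b hb).2.1 (hP.1 b hb).2.2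
    have hcard : ((P.filter fun b => A.level b.2 = k).card : ℝ) ≤
        (4 * B + 1) ^ 2 * A.count (A.ell k) k := by
      exact_mod_cast hB.card_packing_level_le hP k
    calc ∑ b ∈ P with A.level b.2 = k, (2 * b.2) ^ (s : ℝ)
        ≤ ∑ b ∈ P with A.level b.2 = k, (2 * (1 / A.mProd k : ℝ)) ^ (s : ℝ) := by
          refine Finset.sum_le_sum fun b hb => ?_
          obtain ⟨hbP, rfl⟩ := Finset.mem_filter.1 hb
          have h0 := (hP.1 b hbP).2.1
          have h1 := A.le_of_level h0 ((hP.1 b hbP).2.2.trans hδ1)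
          gcongr
      _ = (P.filter fun b => A.level b.2 = k).card * (2 * (1 / A.mProd k : ℝ)) ^ (s : ℝ) := by
          rw [Finset.sum_const, nsmul_eq_mul]
      _ ≤ (4 * B + 1) ^ 2 * A.count (A.ell k) k * (2 * (1 / A.mProd k : ℝ)) ^ (s : ℝ) := by
          gcongr
      _ ≤ (4 * B + 1) ^ 2 * (2 ^ (s : ℝ) * ρ ^ k) := by
          rw [mul_assoc]
          exact mul_le_mul_of_nonneg_left (hlevel k hkk) (by positivity)
      _ = C * ρ ^ k := by ring
  have hsup : Plane.packingSup s (1 / A.mProd k₀) A.moranSet ≤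
      ENNReal.ofReal (∑' k : ℕ, C * ρ ^ k) := by
    refine iSup₂_le fun P hP => ?_
    have h0 : ∀ b ∈ P, 0 ≤ 2 * b.2 := fun b hb => by
      have := (hP.1 b hb).2.1
      positivity
    rw [Finset.sum_congr rfl fun b hb => ENNReal.ofReal_rpow_of_nonneg (h0 b hb) s.coe_nonneg,
      ← ENNReal.ofReal_sum_of_nonneg fun b hb => Real.rpow_nonneg (h0 b hb) _]
    exact ENNReal.ofReal_le_ofReal (hbound P hP)
  have hpos : (0 : ℝ) < 1 / A.mProd k₀ := one_div_pos.2 (hM _)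
  exact ((Plane.packingMeasure_le_packingPreMeasure s _).trans
    ((iInf₂_le _ hpos).trans hsup)).trans_lt ENNReal.ofReal_lt_top |>.ne

/-! ### Lower bound for the packing dimension -/

variable (A) in
theorem two_pow_le_nProd (k : ℕ) : 2 ^ k ≤ A.nProd k := by
  calc 2 ^ k = ∏ _i ∈ Finset.range k, 2 := by simp
    _ ≤ A.nProd k := Finset.prod_le_prod' fun i _ => A.two_le_n i

variable (A) in
theorem exists_cylinder_subset_closure {G : ℕ → Set Plane} (hG : A.moranSet ⊆ ⋃ i, G i) :
    ∃ i p, ∃ g : ℕ → ℕ × ℕ, (∀ j, g j ∈ A.D j) ∧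
      ∀ y ∈ A.moranSet, A.InRectangle g p p y → y ∈ closure (G i) := by
  -- Baire's theorem is applied inside the complete space `moranSet`, to the closures of the pieces.
  have := A.isClosed_moranSet.completeSpace_coe
  have := A.nonempty_moranSet.to_subtype
  obtain ⟨i, x, hx⟩ := nonempty_interior_of_iUnion_of_closed
    (f := fun i => ((↑) : A.moranSet → Plane) ⁻¹' closure (G i))
    (fun i => isClosed_closure.preimage continuous_subtype_val) (by
      refine Set.eq_univ_of_forall fun x => ?_
      obtain ⟨i, hi⟩ := Set.mem_iUnion.1 (hG x.2)
      exact Set.mem_iUnion.2 ⟨i, subset_closure hi⟩)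
  obtain ⟨ε, hε, hball⟩ := Metric.mem_nhds_iff.1 (mem_interior_iff_mem_nhds.1 hx)
  -- Points of one level-`p` cylinder differ by at most `(1 / 2) ^ p` in each coordinate, so the
  -- cylinder through `x` stays in the ball.
  obtain ⟨p, hp⟩ := exists_pow_lt_of_lt_one (half_pos hε) (one_half_lt_one (α := ℝ))
  obtain ⟨g, hg, hgx⟩ := A.exists_inRectangle x.2 p p
  refine ⟨i, p, g, hg, fun y hy hgy => ?_⟩
  refine hball (show (⟨y, hy⟩ : A.moranSet) ∈ Metric.ball x ε from ?_)
  rw [Metric.mem_ball, Subtype.dist_eq]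
  have h0 := hgy.1.abs_sub_le hgx.1 (A.two_pow_le_nProd p)
  have h1 := hgy.2.abs_sub_le hgx.2 (A.two_pow_le_mProd p)
  exact (Plane.dist_le_add _ _).trans_lt (by linarith)

/-- Points of the cylinder more than `3 / mProd k` apart are moved into `F` by less than `1 / (2 *
mProd k)`; they stay over `2 / mProd k` apart, so balls of radius `1 / mProd k` form a packing. Its
sum is at least a constant times `mProd k ^ (t - s)`, for arbitrarily large `k`. -/
theorem IsBound.packingPreMeasure_eq_top {B : ℕ} (hB : A.IsBound B) {s : ℝ≥0} {t : ℝ}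
    (hst : s < t) (ht : ∃ᶠ k in atTop, (A.mProd k : ℝ) ^ t ≤ A.count (A.ell k) k)
    {g : ℕ → ℕ × ℕ} (hg : ∀ j, g j ∈ A.D j) {p : ℕ} {F : Set Plane}
    (hF : ∀ y ∈ A.moranSet, A.InRectangle g p p y → y ∈ closure F) :
    Plane.packingPreMeasure s F = ⊤ := by
  classical
  refine iInf₂_eq_top.2 fun δ hδ => ENNReal.eq_top_of_forall_nnreal_le fun r => ?_
  set C : ℕ := (∏ i ∈ Finset.range p, A.r i) * (3 * B + 2) ^ 2
  have hC : 0 < C := Nat.mul_pos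
    (Finset.prod_pos fun i _ => two_pos.trans_le (A.two_le_card i)) (by positivity)
  have hC' : (0 : ℝ) < C := Nat.cast_pos.2 hC
  have hgrow : Tendsto (fun k => (A.mProd k : ℝ) ^ (t - s)) atTop atTop :=
    (tendsto_rpow_atTop (sub_pos.2 hst)).comp A.tendsto_mProd
  obtain ⟨k, hkt, hkδ, hkr⟩ := (ht.and_eventually
    ((A.tendsto_one_div_mProd.eventually_le_const hδ).and
      (hgrow.eventually_ge_atTop (C * r)))).exists
  have hM : (0 : ℝ) < A.mProd k := Nat.cast_pos.2 (A.mProd_pos k)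
  obtain ⟨S, hSE, hS, hcard⟩ := hB.exists_separated hg p k
  have hnear : ∀ x ∈ S, ∃ y ∈ F, dist x y < 1 / (2 * A.mProd k) := fun x hx =>
    Metric.mem_closure_iff.1 (hF x (hSE x hx).1 (hSE x hx).2) _ (by positivity)
  choose! y hyF hy using hnear
  have hfar : ∀ x ∈ S, ∀ x' ∈ S, x ≠ x' → 2 / (A.mProd k : ℝ) < dist (y x) (y x') := by
    intro x hx x' hx' hne
    have h1 := hS hx hx' hne
    have h2 := hy x hx
    have h3 := hy x' hx'
    have h4 := dist_triangle4 x (y x) (y x') x'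
    rw [dist_comm (y x') x'] at h4
    have h5 : 3 / (A.mProd k : ℝ) = 2 / A.mProd k + 1 / (2 * A.mProd k) + 1 / (2 * A.mProd k) := by
      field_simp
      norm_num
    linarith
  have hinj : Set.InjOn (fun x => (y x, (1 / A.mProd k : ℝ))) S := by
    intro x hx x' hx' heq
    by_contra hne
    have := hfar x hx x' hx' hne
    rw [(Prod.mk.inj heq).1, dist_self] at this
    exact absurd this (not_lt.2 (by positivity))
  have hP : Plane.IsPacking F δ (S.image fun x => (y x, (1 / A.mProd k : ℝ))) := by
    constructor
    · intro b hb
      obtain ⟨x, hx, rfl⟩ := Finset.mem_image.1 hb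
      exact ⟨hyF x hx, one_div_pos.2 hM, hkδ⟩
    · intro b hb b' hb' hne
      obtain ⟨x, hx, rfl⟩ := Finset.mem_image.1 (Finset.mem_coe.1 hb)
      obtain ⟨x', hx', rfl⟩ := Finset.mem_image.1 (Finset.mem_coe.1 hb')
      refine Metric.closedBall_disjoint_closedBall ?_
      refine lt_of_eq_of_lt ?_ (hfar x hx x' hx' fun h => hne (by rw [h]))
      ring
  refine le_iSup₂_of_le _ hP ?_
  rw [Finset.sum_image hinj]
  dsimp only
  rw [Finset.sum_const, nsmul_eq_mul,
    ENNReal.ofReal_rpow_of_nonneg (by positivity) s.coe_nonneg, ← ENNReal.ofReal_natCast,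
    ← ENNReal.ofReal_mul (by positivity), ← ENNReal.ofReal_coe_nnreal]
  refine ENNReal.ofReal_le_ofReal (le_of_mul_le_mul_left ?_ hC')
  have hcard' : (A.count (A.ell k) k : ℝ) ≤ C * S.card := by exact_mod_cast hcard
  calc (C : ℝ) * r ≤ (A.mProd k : ℝ) ^ (t - s) := hkr
    _ = (A.mProd k : ℝ) ^ t * (1 / A.mProd k) ^ (s : ℝ) := by
        rw [one_div, Real.inv_rpow hM.le, Real.rpow_sub hM]
        ring
    _ ≤ (C * S.card) * (2 * (1 / A.mProd k)) ^ (s : ℝ) := by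
        gcongr
        · exact hkt.trans hcard'
        · have : (0 : ℝ) < 1 / A.mProd k := one_div_pos.2 hM
          linarith
    _ = _ := by ring

theorem IsBound.packingMeasure_eq_top {B : ℕ} (hB : A.IsBound B) {s : ℝ≥0} {t : ℝ}
    (hst : s < t) (ht : ∃ᶠ k in atTop, (A.mProd k : ℝ) ^ t ≤ A.count (A.ell k) k) :
    Plane.packingMeasure s A.moranSet = ⊤ := by
  refine iInf₂_eq_top.2 fun G hG => ?_
  obtain ⟨i, p, g, hg, hF⟩ := A.exists_cylinder_subset_closure hG
  exact ENNReal.tsum_eq_top_of_eq_top ⟨i, hB.packingPreMeasure_eq_top hst ht hg hF⟩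

variable (A) in
theorem count_eq_rpow {k : ℕ} (hk : 1 ≤ k) :
    (A.count (A.ell k) k : ℝ) = (A.mProd k : ℝ) ^ A.dimRatio k := by
  have hM := Nat.cast_pos (α := ℝ).2 (A.mProd_pos k)
  have hc := Nat.cast_pos (α := ℝ).2 (A.count_pos (A.ell k) k)
  have hl := (Real.log_pos one_lt_two).trans_le (log_mProd_pos (A := A) hk)
  rw [Real.rpow_def_of_pos hM, dimRatio, mul_div_cancel₀ _ hl.ne', Real.exp_log hc]

variable (A) in
theorem one_le_mProd (k : ℕ) : (1 : ℝ) ≤ A.mProd k := by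
  exact_mod_cast A.mProd_pos k

variable (A) in
theorem dUpper_nonneg : 0 ≤ A.dUpper := by
  calc (0 : EReal) = limsup (fun _ : ℕ => (0 : EReal)) atTop := (limsup_const _).symm
    _ ≤ _ := limsup_le_limsup (Eventually.of_forall fun k =>
      EReal.coe_nonneg.2 (A.dimRatio_nonneg k))

theorem IsBound.packingDim_eq {B : ℕ} (hB : A.IsBound B) :
    (Plane.packingDim A.moranSet : EReal) = A.dUpper := by
  refine le_antisymm ?_ ?_
  · rw [← EReal.coe_toENNReal A.dUpper_nonneg, EReal.coe_ennreal_le_coe_ennreal_iff]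
    refine iSup₂_le fun s hs => ?_
    rw [← EReal.coe_ennreal_le_coe_ennreal_iff, EReal.coe_toENNReal A.dUpper_nonneg]
    by_contra! hlt
    obtain ⟨t, h1, h2⟩ := EReal.lt_iff_exists_real_btwn.1 hlt
    rw [EReal.coe_nnreal_eq_coe_real, EReal.coe_lt_coe_iff] at h2
    refine hB.packingMeasure_ne_top (t := t) h2 ?_ hs
    filter_upwards [eventually_lt_of_limsup_lt h1, eventually_ge_atTop 1] with k hk hk1
    rw [A.count_eq_rpow hk1]
    exact Real.rpow_le_rpow_of_exponent_le (A.one_le_mProd k) (EReal.coe_lt_coe_iff.1 hk).le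
  · by_contra! hlt
    obtain ⟨s, h1, h2⟩ := EReal.lt_iff_exists_real_btwn.1 hlt
    obtain ⟨t, h3, h4⟩ := EReal.lt_iff_exists_real_btwn.1 h2
    -- The intermediate real exceeds a packing dimension, hence is a legitimate nonnegative
    -- exponent.
    have hs : 0 ≤ s := by
      have : (0 : EReal) < s := (EReal.coe_ennreal_nonneg _).trans_lt h1
      exact (EReal.coe_pos.1 this).le
    lift s to ℝ≥0 using hs
    have htop : Plane.packingMeasure s A.moranSet = ⊤ := by
      refine hB.packingMeasure_eq_top (t := t) (by exact_mod_cast h3) ?_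
      have hfreq := (frequently_lt_of_lt_limsup (by isBoundedDefault) h4).and_eventually
        (eventually_ge_atTop 1)
      refine hfreq.mono fun k hk => ?_
      rw [A.count_eq_rpow hk.2]
      exact Real.rpow_le_rpow_of_exponent_le (A.one_le_mProd k) (EReal.coe_lt_coe_iff.1 hk.1).le
    have hle : (s : ℝ≥0∞) ≤ Plane.packingDim A.moranSet :=
      le_iSup₂ (f := fun (s : ℝ≥0) (_ : Plane.packingMeasure s A.moranSet = ⊤) => (s : ℝ≥0∞)) s htop
    rw [← EReal.coe_nnreal_eq_coe_real] at h1
    exact absurd h1 (not_lt.2 (EReal.coe_ennreal_le_coe_ennreal_iff.2 hle))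

end MoranConstruction

theorem theorem2p4 (A : MoranConstruction) (hN : A.Nplus < ⊤) :
    ((Plane.packingDim A.moranSet : ENNReal) : EReal) = A.dUpper ∧
    Plane.upperBoxDim A.moranSet = A.dUpper ∧
    Plane.lowerBoxDim A.moranSet = A.dLower := by
  obtain ⟨B, hB⟩ := A.exists_isBound hN
  exact ⟨hB.packingDim_eq, hB.upperBoxDim_eq, hB.lowerBoxDim_eq⟩
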